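/- Let $n\in\{2,3,4,5\}$ and let $K$ be a perfect field of characteristic not dividing $6n$, with algebraic closure $\overline K$. Let $\zeta_n\in\overline K$ be a primitive $n$th root of unity and let $\Delta_n\subset \mathrm{PGL}_2(\overline K)$ be the subgroup generated by the classes of $\begin{pmatrix}1&0\\0&\zeta_n\end{pmatrix}$ and of the matrix $$\begin{pmatrix}1&1/8\\24&-1\end{pmatrix},\quad \begin{pmatrix}1&1/3\\6&-1\end{pmatrix},\quad \begin{pmatrix}1&1/2\\2&-1\end{pmatrix},\quad \begin{pmatrix}\varphi&1\\1&-\varphi\end{pmatrix}\ (\varphi=1+\zeta_5+\zeta_5^4)$$ for $n=2,3,4,5$ respectively. Let $\widetilde\Gamma_n$ be the inverse image of $\Delta_n$ in $\mathrm{SL}_2(\overline K)$ and $\Gamma_n$ the commutator subgroup of $\widetilde\Gamma_n$. Let $$D=a(64a^2-b^2),\quad -a(27a^3+b^3),\quad ab(16a^4-b^4),\quad ab(a^{10}-11a^5b^5-b^{10})$$ for $n=2,3,4,5$ respectively, and let $c_4,c_6\in\mathbb Z[a,b]$ be the polynomials determined by $$((\deg D)-1)^2\,c_4=-\begin{vmatrix}\frac{\partial^2D}{\partial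 a^2}&\frac{\partial^2D}{\partial a\partial b}\\ \frac{\partial^2D}{\partial a\partial b}&\frac{\partial^2D}{\partial b^2}\end{vmatrix},\qquad (\deg c_4)\,c_6=\begin{vmatrix}\frac{\partial D}{\partial a}&\frac{\partial D}{\partial b}\\ \frac{\partial c_4}{\partial a}&\frac{\partial c_4}{\partial b}\end{vmatrix}.$$ We use the same letters for the images of $D,c_4,c_6$ in $K[a,b]$. A discrete covariant is a pair $p=(p_1,p_2)$ of polynomials $p_1,p_2\in K[a,b]$ such that the map $p:\overline K^2\to\overline K^2$ (on column vectors) satisfies $p\circ\gamma=\gamma\circ p$ for all $\gamma\in\Gamma_n$. Write $U=(a,b)$ and $\partial f=\left(-\frac{\partial f}{\partial b},\frac{\partial f}{\partial a}\right)$ for $f\in K[a,b]$. Then $c_4$ and $c_6$ are invariant under $\Gamma_n$ (that is, $f\circ\gamma=f$ for all $\gamma\in\Gamma_n$), so that the discrete covariants form a module over the ring $K[c_4,c_6]\subset K[a,b]$, and this module is free of rank $2n$ with basis $$D^iU,\quad D^i\,\partial D\quad(i=0,1,\ldots,n-2),\qquad \partial c_4,\quad \partial c_6 .$$ -/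

import Mathlib

open MvPolynomial
open scoped MatrixGroups

noncomputable section

namespace DiscCov

/-! ### The groups -/

/-- The first generator of `Δ_n`, as a matrix; `ζ` is a primitive `n`-th root of unity. -/
def genS {F : Type*} [Field F] (n : ℕ) (ζ : F) : Matrix (Fin 2) (Fin 2) F :=
  match n with
  | 2 => !![1, 1 / 8; 24, -1]
  | 3 => !![1, 1 / 3; 6, -1]
  | 4 => !![1, 1 / 2; 2, -1]
  | 5 => !![1 + ζ + ζ ^ 4, 1; 1, -(1 + ζ + ζ ^ 4)]
  | _ => 1

/-- The second generator of `Δ_n`, as a matrix (for `n = 2` one has `ζ = -1`). -/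
def genT {F : Type*} [Field F] (ζ : F) : Matrix (Fin 2) (Fin 2) F :=
  !![1, 0; 0, ζ]

/-- `Δ_n`, the subgroup of `PGL₂` generated by the classes of the two matrices above. -/
def Delta {F : Type*} [Field F] (n : ℕ) (ζ : F) : Subgroup PGL(2, F) :=
  Subgroup.closure (Matrix.ProjGenLinGroup.mk ''
    {g : GL (Fin 2) F | (g : Matrix (Fin 2) (Fin 2) F) = genS n ζ ∨
      (g : Matrix (Fin 2) (Fin 2) F) = genT ζ})

/-- The inverse image of `Δ_n` in `SL₂`. -/
def GammaTilde {F : Type*} [Field F] (n : ℕ) (ζ : F) : Subgroup SL(2, F) :=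
  (Delta n ζ).comap Matrix.SpecialLinearGroup.toPGL

/-- `Γ_n`, the commutator subgroup of the inverse image of `Δ_n` in `SL₂`. -/
def Gamma {F : Type*} [Field F] (n : ℕ) (ζ : F) : Subgroup SL(2, F) :=
  ⁅GammaTilde n ζ, GammaTilde n ζ⁆

/-! ### The forms `D`, `c₄`, `c₆`

In `R[a, b]` we write `X 0` for `a` and `X 1` for `b`. -/

/-- The form `D`, of degree `12 / (6 - n) = 3, 4, 6, 12`. -/
def D (R : Type*) [CommRing R] (n : ℕ) : MvPolynomial (Fin 2) R :=
  match n with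
  | 2 => X 0 * (64 * X 0 ^ 2 - X 1 ^ 2)
  | 3 => -X 0 * (27 * X 0 ^ 3 + X 1 ^ 3)
  | 4 => X 0 * X 1 * (16 * X 0 ^ 4 - X 1 ^ 4)
  | 5 => X 0 * X 1 * (X 0 ^ 10 - 11 * X 0 ^ 5 * X 1 ^ 5 - X 1 ^ 10)
  | _ => 0

/-- The form `c₄ = -((deg D) - 1)⁻² det Hess(D)`, of degree `4n / (6 - n) = 2, 4, 8, 20`. It has
integer coefficients, and it is written out here because `(deg D) - 1` may vanish in the field
under consideration (characteristic `5` for `n = 4`, characteristic `11` for `n = 5`). The defining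
relation is `c4_spec`; over `ℤ` it determines `c₄`, and the form over `R` is the image of the one
over `ℤ`. -/
def c4 (R : Type*) [CommRing R] (n : ℕ) : MvPolynomial (Fin 2) R :=
  match n with
  | 2 => 192 * X 0 ^ 2 + X 1 ^ 2
  | 3 => -216 * X 0 ^ 3 * X 1 + X 1 ^ 4
  | 4 => 256 * X 0 ^ 8 + 224 * X 0 ^ 4 * X 1 ^ 4 + X 1 ^ 8
  | 5 => X 0 ^ 20 + 228 * X 0 ^ 15 * X 1 ^ 5 + 494 * X 0 ^ 10 * X 1 ^ 10
      - 228 * X 0 ^ 5 * X 1 ^ 15 + X 1 ^ 20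
  | _ => 0

/-- The form `c₆ = (deg c₄)⁻¹ ∂(D, c₄)/∂(a, b)`. It has integer coefficients and is written out
here; the defining relation is `c6_spec`. -/
def c6 (R : Type*) [CommRing R] (n : ℕ) : MvPolynomial (Fin 2) R :=
  match n with
  | 2 => 576 * X 0 ^ 2 * X 1 - X 1 ^ 3
  | 3 => 5832 * X 0 ^ 6 - 540 * X 0 ^ 3 * X 1 ^ 3 - X 1 ^ 6
  | 4 => -4096 * X 0 ^ 12 + 8448 * X 0 ^ 8 * X 1 ^ 4 + 528 * X 0 ^ 4 * X 1 ^ 8 - X 1 ^ 12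
  | 5 => -X 0 ^ 30 + 522 * X 0 ^ 25 * X 1 ^ 5 + 10005 * X 0 ^ 20 * X 1 ^ 10
      + 10005 * X 0 ^ 10 * X 1 ^ 20 - 522 * X 0 ^ 5 * X 1 ^ 25 - X 1 ^ 30
  | _ => 0

/-- `((deg D) - 1)² c₄ = -det Hess(D)`. -/
theorem c4_spec (R : Type*) [CommRing R] (n : ℕ) (h2 : 2 ≤ n) (h5 : n ≤ 5) :
    (((12 / (6 - n) - 1) ^ 2 : ℕ) : MvPolynomial (Fin 2) R) * c4 R n =
      -(!![pderiv 0 (pderiv 0 (D R n)), pderiv 0 (pderiv 1 (D R n));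
          pderiv 0 (pderiv 1 (D R n)), pderiv 1 (pderiv 1 (D R n))] :
        Matrix (Fin 2) (Fin 2) (MvPolynomial (Fin 2) R)).det := by
  have ofN : ∀ (i : Fin 2) (m : ℕ) [m.AtLeastTwo],
      pderiv i (OfNat.ofNat m : MvPolynomial (Fin 2) R) = 0 := fun i m _ => by
    rw [← Nat.cast_ofNat (R := MvPolynomial (Fin 2) R)]
    exact Derivation.map_natCast _ _
  interval_cases n <;>
  · simp [D, c4, Matrix.det_fin_two, ofN, pderiv_X]
    ring

/-- `(deg c₄) c₆ = ∂(D, c₄)/∂(a, b)`. -/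
theorem c6_spec (R : Type*) [CommRing R] (n : ℕ) (h2 : 2 ≤ n) (h5 : n ≤ 5) :
    ((4 * n / (6 - n) : ℕ) : MvPolynomial (Fin 2) R) * c6 R n =
      (!![pderiv 0 (D R n), pderiv 1 (D R n);
          pderiv 0 (c4 R n), pderiv 1 (c4 R n)] :
        Matrix (Fin 2) (Fin 2) (MvPolynomial (Fin 2) R)).det := by
  have ofN : ∀ (i : Fin 2) (m : ℕ) [m.AtLeastTwo],
      pderiv i (OfNat.ofNat m : MvPolynomial (Fin 2) R) = 0 := fun i m _ => by
    rw [← Nat.cast_ofNat (R := MvPolynomial (Fin 2) R)]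
    exact Derivation.map_natCast _ _
  interval_cases n <;>
  · simp [D, c4, c6, Matrix.det_fin_two, ofN, pderiv_X]
    ring

/-! ### Discrete invariants and discrete covariants -/

/-- The ring of discrete invariants `K[a, b]^{Γ_n}`: the polynomials `f` over `K` with
`f ∘ γ = f` for all `γ` in `Γ_n ⊂ SL₂(K̄)`. Here `K²` is identified with its set of
`K̄`-points, on which `SL₂(K̄)` acts by multiplication on column vectors. -/
def discreteInvariants (K : Type*) [Field K] (n : ℕ) (ζ : AlgebraicClosure K) :
    Subalgebra K (MvPolynomial (Fin 2) K) where
  carrier := {f | ∀ γ ∈ Gamma n ζ, ∀ v : Fin 2 → AlgebraicClosure K,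
    aeval (γ.1.mulVec v) f = aeval v f}
  mul_mem' hf hg γ hγ v := by rw [map_mul, map_mul, hf γ hγ v, hg γ hγ v]
  add_mem' hf hg γ hγ v := by rw [map_add, map_add, hf γ hγ v, hg γ hγ v]
  algebraMap_mem' r γ _ v := by rw [AlgHom.commutes, AlgHom.commutes]

/-- The map `K̄² → K̄²` given by a pair of polynomials over `K`. -/
def evalPair {K : Type*} [Field K] (p : Fin 2 → MvPolynomial (Fin 2) K)
    (v : Fin 2 → AlgebraicClosure K) : Fin 2 → AlgebraicClosure K :=
  fun i => aeval v (p i)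

/-- The module `M` of discrete covariants, over the ring of discrete invariants: the pairs of
polynomials `p` over `K` with `p ∘ γ = γ ∘ p` for all `γ` in `Γ_n`. -/
def discreteCovariants (K : Type*) [Field K] (n : ℕ) (ζ : AlgebraicClosure K) :
    Submodule (discreteInvariants K n ζ) (Fin 2 → MvPolynomial (Fin 2) K) where
  carrier := {p | ∀ γ ∈ Gamma n ζ, ∀ v : Fin 2 → AlgebraicClosure K,
    evalPair p (γ.1.mulVec v) = γ.1.mulVec (evalPair p v)}
  zero_mem' γ _ v := by
    have h : ∀ w, evalPair (0 : Fin 2 → MvPolynomial (Fin 2) K) w = 0 := fun w => by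
      ext i; simp [evalPair]
    rw [h, h, Matrix.mulVec_zero]
  add_mem' {p q} hp hq γ hγ v := by
    have h : ∀ w, evalPair (p + q) w = evalPair p w + evalPair q w := fun w => by
      ext i; simp [evalPair]
    rw [h, h, hp γ hγ v, hq γ hγ v, Matrix.mulVec_add]
  smul_mem' f p hp γ hγ v := by
    have h : ∀ w, evalPair (f • p) w = aeval w f.1 • evalPair p w := fun w => by
      ext i; simp [evalPair, Subalgebra.smul_def]
    rw [h, h, hp γ hγ v, f.2 γ hγ v, Matrix.mulVec_smul]

/-- The ring `K[c₄, c₆]`, as a subalgebra of the ring of discrete invariants. -/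
def ringC4C6 (K : Type*) [Field K] (n : ℕ) (ζ : AlgebraicClosure K)
    (h4 : c4 K n ∈ discreteInvariants K n ζ) (h6 : c6 K n ∈ discreteInvariants K n ζ) :
    Subalgebra K (discreteInvariants K n ζ) :=
  Algebra.adjoin K {⟨c4 K n, h4⟩, ⟨c6 K n, h6⟩}

/-- The discrete covariants as a module over the ring of discrete invariants (the submodule
structure; recorded to help instance search). -/
instance (K : Type*) [Field K] (n : ℕ) (ζ : AlgebraicClosure K) :
    Module (discreteInvariants K n ζ) (discreteCovariants K n ζ) :=
  Submodule.module (discreteCovariants K n ζ)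

/-- The scalar multiplication of the previous module structure (to help instance search). -/
instance (K : Type*) [Field K] (n : ℕ) (ζ : AlgebraicClosure K) :
    SMul (discreteInvariants K n ζ) (discreteCovariants K n ζ) :=
  (inferInstance : Module (discreteInvariants K n ζ) (discreteCovariants K n ζ)).toSMul

/-- The discrete covariants as a module over `K[c₄, c₆]`, by restriction of scalars from the ring
of discrete invariants. -/
instance (K : Type*) [Field K] (n : ℕ) (ζ : AlgebraicClosure K)
    (h4 : c4 K n ∈ discreteInvariants K n ζ) (h6 : c6 K n ∈ discreteInvariants K n ζ) :
    Module (ringC4C6 K n ζ h4 h6) (discreteCovariants K n ζ) :=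
  Subalgebra.moduleLeft (ringC4C6 K n ζ h4 h6)

/-- The scalar multiplication of the previous module structure (to help instance search). -/
instance (K : Type*) [Field K] (n : ℕ) (ζ : AlgebraicClosure K)
    (h4 : c4 K n ∈ discreteInvariants K n ζ) (h6 : c6 K n ∈ discreteInvariants K n ζ) :
    SMul (ringC4C6 K n ζ h4 h6) (discreteCovariants K n ζ) :=
  (inferInstance : Module (ringC4C6 K n ζ h4 h6) (discreteCovariants K n ζ)).toSMul

/-- The scalar action of `K[c₄, c₆]` is multiplication of polynomials. -/
theorem ringC4C6_smul_apply (K : Type*) [Field K] (n : ℕ) (ζ : AlgebraicClosure K)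
    (h4 : c4 K n ∈ discreteInvariants K n ζ) (h6 : c6 K n ∈ discreteInvariants K n ζ)
    (c : ringC4C6 K n ζ h4 h6) (p : discreteCovariants K n ζ) (i : Fin 2) :
    ((c • p : discreteCovariants K n ζ) : Fin 2 → MvPolynomial (Fin 2) K) i =
      (c.1.1 : MvPolynomial (Fin 2) K) * (p : Fin 2 → MvPolynomial (Fin 2) K) i :=
  rfl

/-- `U = (a, b)`, the identity map. -/
def U (K : Type*) [Field K] : Fin 2 → MvPolynomial (Fin 2) K := ![X 0, X 1]

/-- `∂ f = (-∂f/∂b, ∂f/∂a)`. -/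
def del {K : Type*} [Field K] (f : MvPolynomial (Fin 2) K) : Fin 2 → MvPolynomial (Fin 2) K :=
  ![-pderiv 1 f, pderiv 0 f]

end DiscCov

end

/-! Put m = 2n/(6 - n), so that D, c₄, c₆ have degrees m + 2, 2m, 3m. The proof studies invariants
on the line a = 0, one of the lines where D vanishes. An invariant vanishing there is divisible by
D, because Γ_n moves this line to all the other zeros of D (`D_dvd`). The restriction of an
invariant contains only powers of b^m (`coeff_eq_zero`), and an invariant of degree m restricts to 0
(`restrict_eq_zero_of_isHomogeneous`; `restrict_eq_zero_of_isHomogeneous_two` for n = 3).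

Since c₄ and c₆ restrict to b^{2m} and -b^{3m}, every invariant agrees on the line with a polynomial
in c₄, c₆. Subtracting it, dividing by D and inducting on the degree shows that 1, D, …, D^{n-1}
span the invariants over K[c₄, c₆], Dⁿ being absorbed by c₄³ - c₆² = 1728 Dⁿ
(`isCombination_of_mem`). They are independent by descent, since on the line c₄ and c₆ satisfy only
the cuspidal relation x³ = y² (`eq_zero_of_sum_eq_zero`).

For a covariant p, Cramer's rule gives D p = A U + B ∂D with A, B invariant. Restricting to a = 0
ties A to B modulo D, and the solutions of this condition come from D ∂c₄ and D ∂c₆. After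
subtracting these and dividing by D, p is a combination of ∂c₄, ∂c₆ over K[c₄, c₆] and of U, ∂D over
the invariants (`exists_eq_of_mem_discreteCovariants`). Finally D^{n-1} U and D^{n-1} ∂D are
themselves combinations of ∂c₄, ∂c₆, since the determinant of the system involved is c₄³ - c₆² up to
a constant; the same determinant gives independence.

What depends on n is collected in `CovariantData` and verified with explicit matrices of Γ_n. -/

open MvPolynomial
open scoped MatrixGroups commutatorElement

noncomputable section

namespace DiscCov

/-! ### Elements of the groups -/

section Groups

variable {F : Type*} [Field F]

/-- The matrix `M` belongs to `Γ_n`. -/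
def IsGammaMatrix (n : ℕ) (ζ : F) (M : Matrix (Fin 2) (Fin 2) F) : Prop :=
  ∃ γ ∈ Gamma n ζ, γ.1 = M

theorem IsGammaMatrix.mul {n : ℕ} {ζ : F} {M N : Matrix (Fin 2) (Fin 2) F}
    (hM : IsGammaMatrix n ζ M) (hN : IsGammaMatrix n ζ N) : IsGammaMatrix n ζ (M * N) := by
  obtain ⟨γ, hγ, rfl⟩ := hM
  obtain ⟨δ, hδ, rfl⟩ := hN
  exact ⟨γ * δ, mul_mem hγ hδ, rfl⟩

theorem IsGammaMatrix.det_eq_one {n : ℕ} {ζ : F} {M : Matrix (Fin 2) (Fin 2) F}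
    (hM : IsGammaMatrix n ζ M) : M.det = 1 := by
  obtain ⟨γ, -, rfl⟩ := hM
  exact γ.2

theorem IsGammaMatrix.of_mul_eq_one {n : ℕ} {ζ : F} {M N : Matrix (Fin 2) (Fin 2) F}
    (hM : IsGammaMatrix n ζ M) (h : M * N = 1) : IsGammaMatrix n ζ N := by
  obtain ⟨γ, hγ, rfl⟩ := hM
  refine ⟨γ⁻¹, inv_mem hγ, ?_⟩
  have h1 : (γ⁻¹).1 * γ.1 = 1 := by
    rw [← Matrix.SpecialLinearGroup.coe_mul, inv_mul_cancel]; rfl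
  calc (γ⁻¹).1 = (γ⁻¹).1 * (γ.1 * N) := by rw [h, mul_one]
    _ = N := by rw [← mul_assoc, h1, one_mul]

theorem mk_mem_Delta_genS {n : ℕ} {ζ : F} (g : GL (Fin 2) F)
    (hg : (g : Matrix (Fin 2) (Fin 2) F) = genS n ζ) :
    Matrix.ProjGenLinGroup.mk g ∈ Delta n ζ :=
  Subgroup.subset_closure ⟨g, Or.inl hg, rfl⟩

theorem mk_mem_Delta_genT {n : ℕ} {ζ : F} (g : GL (Fin 2) F)
    (hg : (g : Matrix (Fin 2) (Fin 2) F) = genT ζ) :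
    Matrix.ProjGenLinGroup.mk g ∈ Delta n ζ :=
  Subgroup.subset_closure ⟨g, Or.inr hg, rfl⟩

/-- Dividing by a square root of the determinant moves g into SL₂ without changing its class in
PGL₂. -/
theorem exists_lift_GammaTilde [IsAlgClosed F] {n : ℕ} {ζ : F} (g : GL (Fin 2) F)
    (hg : Matrix.ProjGenLinGroup.mk g ∈ Delta n ζ) :
    ∃ γ ∈ GammaTilde n ζ, ∃ c : F, c ≠ 0 ∧ γ.1 = c • g.1 := by
  have hd : g.1.det ≠ 0 := g.det.ne_zero
  obtain ⟨c, hc⟩ := IsAlgClosed.exists_pow_nat_eq (g.1.det)⁻¹ (n := 2) (by norm_num)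
  have hc0 : c ≠ 0 := by
    rintro rfl
    rw [zero_pow two_ne_zero] at hc
    exact inv_ne_zero hd hc.symm
  let γ : SL(2, F) := ⟨c • g.1, by rw [Matrix.det_smul, Fintype.card_fin, hc, inv_mul_cancel₀ hd]⟩
  refine ⟨γ, ?_, c, hc0, rfl⟩
  have : Matrix.SpecialLinearGroup.toPGL γ = Matrix.ProjGenLinGroup.mk g := by
    refine (Matrix.ProjGenLinGroup.mk_eq_mk_iff.2 ⟨Units.mk0 c hc0, ?_⟩).symm
    ext i j
    rw [Matrix.SpecialLinearGroup.coe_GL_coe_matrix]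
    simp [γ, mul_comm]
  rw [GammaTilde, Subgroup.mem_comap, this]
  exact hg

/-- Here M = S T S⁻¹ T⁻¹, and the scalars that bring S and T into SL₂ cancel in the commutator. The
form M(TS) = ST keeps inverses out of the explicit checks. -/
theorem isGammaMatrix_of_mul_eq [IsAlgClosed F] {n : ℕ} {ζ : F} (hS : (genS n ζ).det ≠ 0)
    (hT : (genT ζ).det ≠ 0) (M : Matrix (Fin 2) (Fin 2) F) (hM : M.det = 1)
    (h : M * (genT ζ * genS n ζ) = genS n ζ * genT ζ) : IsGammaMatrix n ζ M := by
  obtain ⟨γ, hγ, c, -, hγc⟩ := exists_lift_GammaTilde _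
    (mk_mem_Delta_genS (Matrix.GeneralLinearGroup.mkOfDetNeZero _ hS) rfl)
  obtain ⟨δ, hδ, d, -, hδd⟩ := exists_lift_GammaTilde _
    (mk_mem_Delta_genT (n := n) (Matrix.GeneralLinearGroup.mkOfDetNeZero _ hT) rfl)
  change γ.1 = c • genS n ζ at hγc
  change δ.1 = d • genT ζ at hδd
  let N : SL(2, F) := ⟨M, hM⟩
  have key : N * (δ * γ) = γ * δ := by
    apply Subtype.ext
    have hN : N.1 = M := rfl
    simp only [Matrix.SpecialLinearGroup.coe_mul, hN, hγc, hδd, Matrix.mul_smul,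
      Matrix.smul_mul, h]
    rw [smul_comm]
  refine ⟨⁅γ, δ⁆, Subgroup.commutator_mem_commutator hγ hδ, ?_⟩
  have : ⁅γ, δ⁆ = N := by
    rw [commutatorElement_def, ← key]; group
  rw [this]

/-- A commutator subgroup is normal, and T lies in the ambient group up to a scalar, which does not
affect T⁻¹ M T. -/
theorem IsGammaMatrix.conj [IsAlgClosed F] {n : ℕ} {ζ : F} (hT : (genT ζ).det ≠ 0)
    {M N : Matrix (Fin 2) (Fin 2) F} (hM : IsGammaMatrix n ζ M)
    (h : genT ζ * N = M * genT ζ) : IsGammaMatrix n ζ N := by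
  obtain ⟨δ, hδ, d, hd0, hδd⟩ := exists_lift_GammaTilde _
    (mk_mem_Delta_genT (n := n) (Matrix.GeneralLinearGroup.mkOfDetNeZero _ hT) rfl)
  change δ.1 = d • genT ζ at hδd
  obtain ⟨γ, hγ, rfl⟩ := hM
  have hγ' : γ ∈ GammaTilde n ζ := Subgroup.commutator_le_self _ hγ
  refine ⟨δ⁻¹ * γ * δ, ?_, ?_⟩
  · have : δ⁻¹ * γ * δ = ⁅δ⁻¹, γ⁆ * γ := by rw [commutatorElement_def]; group
    rw [this]
    exact mul_mem (Subgroup.commutator_mem_commutator (inv_mem hδ) hγ') hγ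
  · have h1 : (δ⁻¹).1 * δ.1 = 1 := by
      rw [← Matrix.SpecialLinearGroup.coe_mul, inv_mul_cancel]; rfl
    have h2 : γ.1 * δ.1 = δ.1 * N := by rw [hδd, Matrix.mul_smul, Matrix.smul_mul, h]
    rw [Matrix.SpecialLinearGroup.coe_mul, Matrix.SpecialLinearGroup.coe_mul, mul_assoc, h2,
      ← mul_assoc, h1, one_mul]

theorem eval_smul_of_isHomogeneous {f : MvPolynomial (Fin 2) F} {k : ℕ} (hf : f.IsHomogeneous k)
    (u : F) (v : Fin 2 → F) : eval (u • v) f = u ^ k * eval v f := by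
  rw [eval_eq', eval_eq', Finset.mul_sum]
  refine Finset.sum_congr rfl fun d hd => ?_
  have hk : d.degree = k := by
    by_contra h
    exact mem_support_iff.1 hd (hf.coeff_eq_zero h)
  rw [← hk, Finsupp.degree_eq_sum]
  simp only [Pi.smul_apply, smul_eq_mul, mul_pow, Fin.prod_univ_two, Fin.sum_univ_two, pow_add]
  ring

/-- The group of the invertible matrices under which `f` is semi-invariant. -/
def semiStabilizer (f : MvPolynomial (Fin 2) F) : Subgroup (GL (Fin 2) F) where
  carrier := {g | ∃ c : Fˣ, ∀ v, eval (g.1.mulVec v) f = c * eval v f}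
  one_mem' := ⟨1, fun v => by simp⟩
  mul_mem' := by
    rintro g h ⟨c, hc⟩ ⟨d, hd⟩
    refine ⟨c * d, fun v => ?_⟩
    rw [Units.val_mul, ← Matrix.mulVec_mulVec, hc, hd, Units.val_mul, mul_assoc]
  inv_mem' := by
    rintro g ⟨c, hc⟩
    refine ⟨c⁻¹, fun v => ?_⟩
    have := hc ((g⁻¹).1.mulVec v)
    rw [Matrix.mulVec_mulVec, ← Units.val_mul, mul_inv_cancel, Units.val_one,
      Matrix.one_mulVec] at this
    rw [this, Units.inv_mul_cancel_left]

theorem scalar_mem_semiStabilizer {f : MvPolynomial (Fin 2) F} {k : ℕ} (hf : f.IsHomogeneous k)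
    (u : Fˣ) : Matrix.GeneralLinearGroup.scalar (Fin 2) u ∈ semiStabilizer f := by
  refine ⟨u ^ k, fun v => ?_⟩
  have : (Matrix.GeneralLinearGroup.scalar (Fin 2) u).1.mulVec v = (u : F) • v := by
    ext i
    simp [Matrix.mulVec_diagonal]
  rw [this, eval_smul_of_isHomogeneous hf, Units.val_pow_eq_pow_val]

/-- Both generators multiply f by a constant, and so do scalars by homogeneity; hence so does every
element of `GammaTilde`. In a commutator these constants cancel. -/
theorem eval_mulVec_eq_of_mem_Gamma {f : MvPolynomial (Fin 2) F} {k : ℕ} (hf : f.IsHomogeneous k)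
    {n : ℕ} {ζ : F} {c d : F} (hc : c ≠ 0) (hd : d ≠ 0)
    (hS : ∀ v, eval ((genS n ζ).mulVec v) f = c * eval v f)
    (hT : ∀ v, eval ((genT ζ).mulVec v) f = d * eval v f)
    {γ : SL(2, F)} (hγ : γ ∈ Gamma n ζ) (v : Fin 2 → F) : eval (γ.1.mulVec v) f = eval v f := by
  have hΔ : Delta n ζ ≤ (semiStabilizer f).map Matrix.ProjGenLinGroup.mk := by
    rw [Delta, Subgroup.closure_le]
    rintro _ ⟨g, hg | hg, rfl⟩
    · exact ⟨g, ⟨Units.mk0 c hc, fun v => by rw [hg]; exact hS v⟩, rfl⟩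
    · exact ⟨g, ⟨Units.mk0 d hd, fun v => by rw [hg]; exact hT v⟩, rfl⟩
  have hSL : ∀ γ ∈ GammaTilde n ζ, Matrix.SpecialLinearGroup.toGL γ ∈ semiStabilizer f := by
    intro γ hγ
    obtain ⟨g, hg, hgγ⟩ := hΔ hγ
    obtain ⟨u, hu⟩ := Matrix.ProjGenLinGroup.mk_eq_mk_iff.1 hgγ
    rw [← hu]
    exact mul_mem hg (scalar_mem_semiStabilizer hf u)
  let H : Subgroup SL(2, F) :=
    { carrier := {γ | ∀ v, eval (γ.1.mulVec v) f = eval v f}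
      one_mem' := fun v => by simp
      mul_mem' := by
        intro a b ha hb v
        rw [Matrix.SpecialLinearGroup.coe_mul, ← Matrix.mulVec_mulVec, ha, hb]
      inv_mem' := by
        intro a ha v
        have := ha ((a⁻¹).1.mulVec v)
        rwa [Matrix.mulVec_mulVec, ← Matrix.SpecialLinearGroup.coe_mul, mul_inv_cancel,
          Matrix.SpecialLinearGroup.coe_one, Matrix.one_mulVec, eq_comm] at this }
  have hle : Gamma n ζ ≤ H := by
    rw [Gamma, Subgroup.commutator_le]
    intro a ha b hb v
    obtain ⟨x, hx⟩ := hSL a ha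
    obtain ⟨y, hy⟩ := hSL b hb
    obtain ⟨z, hz⟩ := hSL _ (inv_mem ha)
    obtain ⟨w, hw⟩ := hSL _ (inv_mem hb)
    simp only [Matrix.SpecialLinearGroup.coe_GL_coe_matrix] at hx hy hz hw
    -- The identity is kept multiplied by the value of f, so that f = 0 needs no separate treatment.
    have hxz : ∀ v, (x * z : F) * eval v f = eval v f := fun v => by
      rw [mul_assoc, ← hz, ← hx, Matrix.mulVec_mulVec, ← Matrix.SpecialLinearGroup.coe_mul,
        mul_inv_cancel, Matrix.SpecialLinearGroup.coe_one, Matrix.one_mulVec]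
    have hyw : ∀ v, (y * w : F) * eval v f = eval v f := fun v => by
      rw [mul_assoc, ← hw, ← hy, Matrix.mulVec_mulVec, ← Matrix.SpecialLinearGroup.coe_mul,
        mul_inv_cancel, Matrix.SpecialLinearGroup.coe_one, Matrix.one_mulVec]
    rw [commutatorElement_def]
    simp only [Matrix.SpecialLinearGroup.coe_mul, ← Matrix.mulVec_mulVec, hx, hy, hz, hw]
    calc (x : F) * (y * (z * (w * eval v f))) = (x * z) * ((y * w) * eval v f) := by ring
      _ = _ := by rw [hyw, hxz]
  exact hle hγ v

end Groups

/-! ### Linear substitutions and restriction to a line -/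

section Substitution

variable {R : Type*} [CommRing R]

/-- The substitution `f ↦ f ∘ M`. -/
def subst (M : Matrix (Fin 2) (Fin 2) R) :
    MvPolynomial (Fin 2) R →ₐ[R] MvPolynomial (Fin 2) R :=
  aeval fun i => C (M i 0) * X 0 + C (M i 1) * X 1

theorem subst_X (M : Matrix (Fin 2) (Fin 2) R) (i : Fin 2) :
    subst M (X i) = C (M i 0) * X 0 + C (M i 1) * X 1 := by
  simp [subst]

theorem eval_subst (M : Matrix (Fin 2) (Fin 2) R) (f : MvPolynomial (Fin 2) R) (v : Fin 2 → R) :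
    eval v (subst M f) = eval (M.mulVec v) f := by
  have : (eval v).comp (subst M).toRingHom = eval (M.mulVec v) := by
    apply MvPolynomial.ringHom_ext
    · intro r; simp [subst]
    · intro i
      fin_cases i <;> simp [subst]
  exact congrArg (fun g => g f) this

theorem isHomogeneous_subst (M : Matrix (Fin 2) (Fin 2) R) {f : MvPolynomial (Fin 2) R} {k : ℕ}
    (hf : f.IsHomogeneous k) : (subst M f).IsHomogeneous k := by
  have := hf.aeval (τ := Fin 2) (fun i => C (M i 0) * X 0 + C (M i 1) * X 1) (n := 1) fun i =>
    (isHomogeneous_C_mul_X _ _).add (isHomogeneous_C_mul_X _ _)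
  rwa [one_mul] at this

theorem homogeneousComponent_subst (M : Matrix (Fin 2) (Fin 2) R) (f : MvPolynomial (Fin 2) R)
    (k : ℕ) : homogeneousComponent k (subst M f) = subst M (homogeneousComponent k f) := by
  conv_lhs => rw [← sum_homogeneousComponent f]
  rw [map_sum, map_sum]
  have h : ∀ i, homogeneousComponent k (subst M (homogeneousComponent i f)) =
      if k = i then subst M (homogeneousComponent i f) else 0 := fun i =>
    homogeneousComponent_of_mem (isHomogeneous_subst M (homogeneousComponent_isHomogeneous i f))
  simp only [h, Finset.sum_ite_eq, Finset.mem_range]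
  split_ifs with hk
  · rfl
  · rw [homogeneousComponent_eq_zero _ _ (by omega), map_zero]

theorem map_homogeneousComponent {S : Type*} [CommRing S] (g : R →+* S)
    (f : MvPolynomial (Fin 2) R) (k : ℕ) :
    map g (homogeneousComponent k f) = homogeneousComponent k (map g f) := by
  ext d
  rw [coeff_map, coeff_homogeneousComponent, coeff_homogeneousComponent, coeff_map]
  split_ifs <;> simp

/-- The chain rule. -/
theorem pderiv_subst (M : Matrix (Fin 2) (Fin 2) R) (f : MvPolynomial (Fin 2) R) (j : Fin 2) :
    pderiv j (subst M f) =
      C (M 0 j) * subst M (pderiv 0 f) + C (M 1 j) * subst M (pderiv 1 f) := by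
  induction f using MvPolynomial.induction_on with
  | C a => simp [subst]
  | add p q hp hq => simp only [map_add, hp, hq]; ring
  | mul_X p i hp =>
    rw [map_mul, Derivation.leibniz, Derivation.leibniz, Derivation.leibniz, hp, subst_X]
    fin_cases i <;> fin_cases j <;>
    · simp [pderiv_X, subst_X]
      ring

/-- Restriction to the line `a = 0`. -/
def restrict : MvPolynomial (Fin 2) R →ₐ[R] Polynomial R := aeval ![0, Polynomial.X]

@[simp] theorem restrict_X_zero : restrict (X 0 : MvPolynomial (Fin 2) R) = 0 := by
  simp [restrict]

@[simp] theorem restrict_X_one : restrict (X 1 : MvPolynomial (Fin 2) R) = Polynomial.X := by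
  simp [restrict]

/-- Modulo a, every polynomial equals its restriction rewritten as a polynomial in b. -/
theorem X_zero_dvd_of_restrict_eq_zero {f : MvPolynomial (Fin 2) R} (hf : restrict f = 0) :
    X 0 ∣ f := by
  have h : ∀ g : MvPolynomial (Fin 2) R,
      X 0 ∣ g - Polynomial.aeval (X 1 : MvPolynomial (Fin 2) R) (restrict g) := by
    intro g
    induction g using MvPolynomial.induction_on with
    | C a => simp [restrict]
    | add p q hp hq =>
      simp only [map_add]
      convert! dvd_add hp hq using 1
      ring
    | mul_X p i hp =>
      rw [map_mul, map_mul]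
      fin_cases i
      · simp
      · simp only [Fin.mk_one, restrict_X_one, Polynomial.aeval_X, ← sub_mul]
        exact hp.mul_right _
  simpa [hf] using h f

theorem restrict_of_isHomogeneous {f : MvPolynomial (Fin 2) R} {k : ℕ} (hf : f.IsHomogeneous k) :
    restrict f = Polynomial.C ((restrict f).coeff k) * Polynomial.X ^ k := by
  have h : ∃ r : R, restrict f = Polynomial.C r * Polynomial.X ^ k := by
    rw [f.as_sum, map_sum]
    have : ∀ d ∈ f.support, ∃ r : R,
        restrict (monomial d (coeff d f)) = Polynomial.C r * Polynomial.X ^ k := by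
      intro d hd
      have hk : d.degree = k := by
        by_contra h
        exact mem_support_iff.1 hd (hf.coeff_eq_zero h)
      rw [Finsupp.degree_eq_sum, Fin.sum_univ_two] at hk
      rw [restrict, aeval_monomial, Finsupp.prod_fintype _ _ (fun i => pow_zero _),
        Fin.prod_univ_two]
      by_cases h0 : d 0 = 0
      · refine ⟨coeff d f, ?_⟩
        rw [h0, zero_add] at hk
        simp [h0, hk]
      · exact ⟨0, by simp [h0]⟩
    choose! r hr using this
    exact ⟨∑ d ∈ f.support, r d, by
      rw [Finset.sum_congr rfl hr, map_sum, Finset.sum_mul]⟩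
  obtain ⟨r, hr⟩ := h
  rw [hr]
  simp

end Substitution

/-! ### Divisibility over a field extension. -/

section Descent

variable {K F : Type*} [Field K] [Field F] [Algebra K F]

/-- A K-linear retraction F → K, applied to the coefficients of the quotient over F, yields a
quotient over K. -/
theorem dvd_of_map_dvd_map {f g : MvPolynomial (Fin 2) K}
    (h : map (algebraMap K F) f ∣ map (algebraMap K F) g) : f ∣ g := by
  obtain ⟨q, hq⟩ := h
  obtain ⟨ρ, hρ⟩ := LinearMap.exists_leftInverse_of_injective (Algebra.linearMap K F)
    (LinearMap.ker_eq_bot.2 (algebraMap K F).injective)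
  have hρ' : ∀ (a : K) (x : F), ρ (algebraMap K F a * x) = a * ρ x := fun a x => by
    rw [← Algebra.smul_def, map_smul, smul_eq_mul]
  have hρ1 : ∀ a : K, ρ (algebraMap K F a) = a := fun a => congrArg (fun l => l a) hρ
  let q' : MvPolynomial (Fin 2) K := ∑ d ∈ q.support, monomial d (ρ (coeff d q))
  have hq' : ∀ d, coeff d q' = ρ (coeff d q) := fun d => by
    classical
    simp only [q', coeff_sum, coeff_monomial, Finset.sum_ite_eq']
    split_ifs with h
    · rfl
    · rw [notMem_support_iff.1 h, map_zero]
  refine ⟨q', ?_⟩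
  ext d
  rw [coeff_mul, ← hρ1 (coeff d g), ← coeff_map, hq, coeff_mul, map_sum]
  refine Finset.sum_congr rfl fun x _ => ?_
  rw [coeff_map, hρ', hq']

end Descent

/-! ### Invariants -/

section Invariants

variable {K : Type*} [Field K] {n : ℕ} {ζ : AlgebraicClosure K}

local notation "φK" => algebraMap K (AlgebraicClosure K)

theorem subst_map_of_mem {f : MvPolynomial (Fin 2) K} (hf : f ∈ discreteInvariants K n ζ)
    {M : Matrix (Fin 2) (Fin 2) (AlgebraicClosure K)} (hM : IsGammaMatrix n ζ M) :
    subst M (map φK f) = map φK f := by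
  obtain ⟨γ, hγ, rfl⟩ := hM
  refine MvPolynomial.funext fun v => ?_
  rw [eval_subst, eval_map, eval_map]
  exact hf γ hγ v

theorem mem_discreteInvariants_of_subst {f : MvPolynomial (Fin 2) K}
    (h : ∀ γ ∈ Gamma n ζ, subst γ.1 (map φK f) = map φK f) :
    f ∈ discreteInvariants K n ζ := by
  intro γ hγ v
  have := congrArg (eval v) (h γ hγ)
  rwa [eval_subst, eval_map, eval_map] at this

theorem homogeneousComponent_mem_discreteInvariants {f : MvPolynomial (Fin 2) K}
    (hf : f ∈ discreteInvariants K n ζ) (k : ℕ) :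
    homogeneousComponent k f ∈ discreteInvariants K n ζ := by
  refine mem_discreteInvariants_of_subst fun γ hγ => ?_
  rw [map_homogeneousComponent, ← homogeneousComponent_subst, subst_map_of_mem hf ⟨γ, hγ, rfl⟩]

theorem mem_discreteInvariants_of_mul_mem {f g : MvPolynomial (Fin 2) K} (hf0 : f ≠ 0)
    (hf : f ∈ discreteInvariants K n ζ) (hfg : f * g ∈ discreteInvariants K n ζ) :
    g ∈ discreteInvariants K n ζ := by
  refine mem_discreteInvariants_of_subst fun γ hγ => ?_
  have h := subst_map_of_mem hfg ⟨γ, hγ, rfl⟩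
  rw [map_mul, map_mul, subst_map_of_mem hf ⟨γ, hγ, rfl⟩] at h
  exact mul_left_cancel₀
    ((map_ne_zero_iff _ (map_injective _ (algebraMap K _).injective)).2 hf0) h

theorem aeval_eq_aeval_restrict (f : MvPolynomial (Fin 2) K) (x : AlgebraicClosure K) :
    aeval ![0, x] f = Polynomial.aeval x (restrict f) := by
  have : (aeval ![0, x] : MvPolynomial (Fin 2) K →ₐ[K] AlgebraicClosure K) =
      (Polynomial.aeval x).comp restrict := by
    ext i
    fin_cases i <;> simp [restrict]
  exact congrArg (fun g => g f) this

/-- The diagonal matrix preserves the line a = 0 and scales b by w, so it multiplies the coefficient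
of b^k by w^k. -/
theorem coeff_restrict_eq_zero_of_mem {f : MvPolynomial (Fin 2) K}
    (hf : f ∈ discreteInvariants K n ζ) {u w : AlgebraicClosure K}
    (hM : IsGammaMatrix n ζ !![u, 0; 0, w]) {k : ℕ} (hk : w ^ k ≠ 1) :
    (restrict f).coeff k = 0 := by
  obtain ⟨γ, hγ, hM⟩ := hM
  have h : ((restrict f).map φK).comp (Polynomial.C w * Polynomial.X) = (restrict f).map φK := by
    refine Polynomial.funext fun x => ?_
    have := hf γ hγ ![0, x]
    have hv : γ.1.mulVec ![0, x] = ![0, w * x] := by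
      rw [hM]; ext i; fin_cases i <;> simp [mul_comm]
    rw [hv, aeval_eq_aeval_restrict, aeval_eq_aeval_restrict] at this
    simpa [Polynomial.eval_map_algebraMap] using this
  have h2 := congrArg (fun p => p.coeff k) h
  simp only [Polynomial.comp_C_mul_X_coeff, Polynomial.coeff_map] at h2
  by_contra h0
  have : φK ((restrict f).coeff k) ≠ 0 := (map_ne_zero _).2 h0
  exact hk (mul_left_cancel₀ this (by rw [h2, mul_one]))

end Invariants

/-! ### Divisibility by linear forms -/

section LinearForms

variable {F : Type*} [Field F]

theorem isRelPrime_X_zero_X_one : IsRelPrime (X 0 : MvPolynomial (Fin 2) F) (X 1) := by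
  refine (Irreducible.isRelPrime_iff_not_dvd X_prime.irreducible).2 fun h => ?_
  rw [X_dvd_X] at h
  simp at h

/-- A common divisor divides a power of a and a power of b. -/
theorem isRelPrime_of_linear_combination {f g : MvPolynomial (Fin 2) F} {i j : ℕ}
    (p q r s : MvPolynomial (Fin 2) F)
    (h0 : p * f + q * g = X 0 ^ i) (h1 : r * f + s * g = X 1 ^ j) : IsRelPrime f g := by
  intro d hf hg
  have hd0 : d ∣ X 0 ^ i := h0 ▸ dvd_add (hf.mul_left _) (hg.mul_left _)
  have hd1 : d ∣ X 1 ^ j := h1 ▸ dvd_add (hf.mul_left _) (hg.mul_left _)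
  exact (isRelPrime_X_zero_X_one.pow (m := i) (n := j)) hd0 hd1

/-- The product of the linear forms `α a + β ζ^j b`. -/
theorem sub_pow_dvd_of_forall_dvd {n : ℕ} (hn : 0 < n) {ζ : F} (hζ : IsPrimitiveRoot ζ n)
    {α β : F} (hα : α ≠ 0) (hβ : β ≠ 0) {g : MvPolynomial (Fin 2) F}
    (h : ∀ j : ℕ, C α * X 0 + C (β * ζ ^ j) * X 1 ∣ g) :
    C (α ^ n) * X 0 ^ n - C ((-β) ^ n) * X 1 ^ n ∣ g := by
  classical
  have hζ' : IsPrimitiveRoot (C ζ : MvPolynomial (Fin 2) F) n :=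
    hζ.map_of_injective (C_injective (Fin 2) F)
  rw [C_pow, C_pow, ← mul_pow, ← mul_pow,
    hζ'.pow_sub_pow_eq_prod_sub_mul _ _ hn]
  have hroot : ∀ x ∈ Polynomial.nthRootsFinset n (1 : MvPolynomial (Fin 2) F),
      ∃ j : ℕ, x = C (ζ ^ j) := by
    intro x hx
    have : NeZero n := ⟨hn.ne'⟩
    obtain ⟨j, -, rfl⟩ := hζ'.eq_pow_of_pow_eq_one ((Polynomial.mem_nthRootsFinset hn _).1 hx)
    exact ⟨j, by rw [C_pow]⟩
  refine Finset.prod_dvd_of_isRelPrime ?_ ?_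
  · intro x hx y hy hxy
    obtain ⟨i, rfl⟩ := hroot x hx
    obtain ⟨j, rfl⟩ := hroot y hy
    have hij : ζ ^ i - ζ ^ j ≠ 0 := fun h => hxy (by rw [sub_eq_zero.1 h])
    have e1 : (C (ζ ^ i - ζ ^ j)⁻¹ : MvPolynomial (Fin 2) F) * (C (ζ ^ i) - C (ζ ^ j)) = 1 := by
      rw [← C_sub, ← C_mul, inv_mul_cancel₀ hij, C_1]
    have e2 : (C α⁻¹ : MvPolynomial (Fin 2) F) * C α = 1 := by
      rw [← C_mul, inv_mul_cancel₀ hα, C_1]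
    have e3 : (C β⁻¹ : MvPolynomial (Fin 2) F) * C β = 1 := by
      rw [← C_mul, inv_mul_cancel₀ hβ, C_1]
    -- The coefficients invert the 2 × 2 system formed by the two linear forms, whose determinant is
    -- αβ(ζ^i - ζ^j) up to sign.
    refine isRelPrime_of_linear_combination (i := 1) (j := 1)
      (- C α⁻¹ * C (ζ ^ i - ζ ^ j)⁻¹ * C (ζ ^ j)) (C α⁻¹ * C (ζ ^ i - ζ ^ j)⁻¹ * C (ζ ^ i))
      (C β⁻¹ * C (ζ ^ i - ζ ^ j)⁻¹) (- C β⁻¹ * C (ζ ^ i - ζ ^ j)⁻¹) ?_ ?_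
    · rw [C_neg]
      linear_combination X 0 * C α⁻¹ * C α * e1 + X 0 * e2
    · rw [C_neg]
      linear_combination X 1 * C β⁻¹ * C β * e1 + X 1 * e3
  · intro x hx
    obtain ⟨j, rfl⟩ := hroot x hx
    convert! h j using 1
    rw [C_neg, C_mul]; ring

theorem isRelPrime_X_zero_binomial {n : ℕ} (hn : 0 < n) {A B : F} (hB : B ≠ 0) :
    IsRelPrime (X 0 : MvPolynomial (Fin 2) F) (C A * X 0 ^ n - C B * X 1 ^ n) := by
  obtain ⟨k, rfl⟩ := Nat.exists_eq_add_one_of_ne_zero hn.ne'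
  have e : (C B⁻¹ : MvPolynomial (Fin 2) F) * C B = 1 := by
    rw [← C_mul, inv_mul_cancel₀ hB, C_1]
  refine isRelPrime_of_linear_combination (i := 1) (j := k + 1) 1 0
    (C B⁻¹ * C A * X 0 ^ k) (- C B⁻¹) (by ring) ?_
  linear_combination X 1 ^ (k + 1) * e

theorem isRelPrime_X_one_binomial {n : ℕ} (hn : 0 < n) {A B : F} (hA : A ≠ 0) :
    IsRelPrime (X 1 : MvPolynomial (Fin 2) F) (C A * X 0 ^ n - C B * X 1 ^ n) := by
  obtain ⟨k, rfl⟩ := Nat.exists_eq_add_one_of_ne_zero hn.ne'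
  have e : (C A⁻¹ : MvPolynomial (Fin 2) F) * C A = 1 := by
    rw [← C_mul, inv_mul_cancel₀ hA, C_1]
  refine isRelPrime_of_linear_combination (i := k + 1) (j := 1)
    (C A⁻¹ * C B * X 1 ^ k) (C A⁻¹) 1 0 ?_ (by ring)
  linear_combination X 0 ^ (k + 1) * e

theorem isRelPrime_binomial_binomial {n : ℕ} {A B A' B' : F} (h : A * B' - A' * B ≠ 0) :
    IsRelPrime (C A * X 0 ^ n - C B * X 1 ^ n : MvPolynomial (Fin 2) F)
      (C A' * X 0 ^ n - C B' * X 1 ^ n) := by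
  have e : (C (A * B' - A' * B)⁻¹ : MvPolynomial (Fin 2) F) * (C A * C B' - C A' * C B) = 1 := by
    rw [← C_mul, ← C_mul, ← C_sub, ← C_mul, inv_mul_cancel₀ h, C_1]
  refine isRelPrime_of_linear_combination (i := n) (j := n)
    (C (A * B' - A' * B)⁻¹ * C B') (- C (A * B' - A' * B)⁻¹ * C B)
    (C (A * B' - A' * B)⁻¹ * C A') (- C (A * B' - A' * B)⁻¹ * C A) ?_ ?_
  · linear_combination X 0 ^ n * e
  · linear_combination X 1 ^ n * e

end LinearForms

/-! ### The cuspidal cubic -/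

section Cusp

variable {K : Type*} [Field K]

/-- Division by y² - x³, monic in y, leaves a remainder of degree at most 1 in y. -/
theorem exists_cusp_normal_form (P : MvPolynomial (Fin 2) K) :
    ∃ (p q : Polynomial K) (Q : MvPolynomial (Fin 2) K),
      P = Polynomial.aeval (X 0) p + Polynomial.aeval (X 0) q * X 1 + (X 0 ^ 3 - X 1 ^ 2) * Q := by
  induction P using MvPolynomial.induction_on with
  | C a => exact ⟨Polynomial.C a, 0, 0, by simp⟩
  | add P P' hP hP' =>
    obtain ⟨p, q, Q, rfl⟩ := hP
    obtain ⟨p', q', Q', rfl⟩ := hP'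
    exact ⟨p + p', q + q', Q + Q', by simp only [map_add]; ring⟩
  | mul_X P i hP =>
    obtain ⟨p, q, Q, rfl⟩ := hP
    fin_cases i
    · exact ⟨p * Polynomial.X, q * Polynomial.X, Q * X 0, by simp; ring⟩
    · exact ⟨q * Polynomial.X ^ 3, p, Q * X 1 - Polynomial.aeval (X 0) q, by simp; ring⟩

/-- The exponents on the left are even multiples of m, those on the right odd multiples. -/
theorem eq_zero_of_expand_eq_expand_mul {m : ℕ} (hm : 0 < m) {p q : Polynomial K} {j : ℕ}
    (h : Polynomial.expand K (2 * m) p =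
      Polynomial.expand K (2 * m) q * Polynomial.X ^ (m * (2 * j + 1))) : p = 0 ∧ q = 0 := by
  have hp : p = 0 := by
    ext k
    have := congrArg (fun f => f.coeff (k * (2 * m))) h
    simp only [Polynomial.coeff_expand_mul (show 0 < 2 * m by omega),
      Polynomial.coeff_mul_X_pow'] at this
    rw [this, Polynomial.coeff_zero]
    split_ifs with hk
    · rw [Polynomial.coeff_expand (by omega), if_neg]
      rintro ⟨c, hc⟩
      have h2 : k * (2 * m) = m * (2 * (c + j) + 1) := by
        have := Nat.sub_add_cancel hk
        rw [← this, hc]; ring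
      have h3 : k * 2 = 2 * (c + j) + 1 := Nat.eq_of_mul_eq_mul_left hm (by rw [← h2]; ring)
      omega
    · rfl
  refine ⟨hp, ?_⟩
  rw [hp, map_zero, eq_comm, mul_eq_zero] at h
  rcases h with h | h
  · exact (Polynomial.expand_eq_zero (by omega)).1 h
  · exact absurd h (pow_ne_zero _ Polynomial.X_ne_zero)

end Cusp

/-! ### Graded components of a product. -/

section Homogeneous

variable {R : Type*} [CommRing R]

theorem homogeneousComponent_mul_of_isHomogeneous {f : MvPolynomial (Fin 2) R} {d : ℕ}
    (hf : f.IsHomogeneous d) (g : MvPolynomial (Fin 2) R) (k : ℕ) :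
    homogeneousComponent k (f * g) =
      if d ≤ k then f * homogeneousComponent (k - d) g else 0 := by
  conv_lhs => rw [← sum_homogeneousComponent g]
  rw [Finset.mul_sum, map_sum]
  have h : ∀ i, homogeneousComponent k (f * homogeneousComponent i g) =
      if k = d + i then f * homogeneousComponent i g else 0 := fun i =>
    homogeneousComponent_of_mem (hf.mul (homogeneousComponent_isHomogeneous i g))
  simp only [h]
  split_ifs with hk
  · have h' : ∀ i, (k = d + i) = (k - d = i) := fun i => by
      apply propext; omega
    simp only [h', Finset.sum_ite_eq, Finset.mem_range]
    split_ifs with hk'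
    · rfl
    · rw [homogeneousComponent_eq_zero _ _ (by omega), mul_zero]
  · exact Finset.sum_eq_zero fun i _ => if_neg (by omega)

end Homogeneous

/-- The properties of `D`, `c₄`, `c₆` and `Γ_n` from which the structure of the module of
covariants is derived. Here `m`, `2m`, `3m` and `m + 2` are half of the degree of `c₄` and the
degrees of `c₄`, `c₆`, `D`. -/
structure CovariantData (K : Type*) [Field K] (n : ℕ) (ζ : AlgebraicClosure K) (m : ℕ) :
    Prop where
  two_le : 2 ≤ n
  m_pos : 0 < m
  two_ne : (2 : K) ≠ 0
  three_ne : (3 : K) ≠ 0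
  m_ne : (m : K) ≠ 0
  m_add_two_ne : (m + 2 : K) ≠ 0
  D_mem : D K n ∈ discreteInvariants K n ζ
  c4_mem : c4 K n ∈ discreteInvariants K n ζ
  c6_mem : c6 K n ∈ discreteInvariants K n ζ
  D_hom : (D K n).IsHomogeneous (m + 2)
  c4_hom : (c4 K n).IsHomogeneous (2 * m)
  c6_hom : (c6 K n).IsHomogeneous (3 * m)
  restrict_D : restrict (D K n) = 0
  restrict_c4 : restrict (c4 K n) = Polynomial.X ^ (2 * m)
  restrict_c6 : restrict (c6 K n) = -Polynomial.X ^ (3 * m)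
  restrict_pderiv : restrict (pderiv 0 (D K n)) = -Polynomial.X ^ (m + 1)
  relation : c4 K n ^ 3 - c6 K n ^ 2 = 1728 * D K n ^ n
  jacobian_c4 : pderiv 0 (D K n) * pderiv 1 (c4 K n) - pderiv 1 (D K n) * pderiv 0 (c4 K n) =
    (2 * m : ℕ) * c6 K n
  jacobian_c6 : pderiv 0 (D K n) * pderiv 1 (c6 K n) - pderiv 1 (D K n) * pderiv 0 (c6 K n) =
    (3 * m : ℕ) * c4 K n ^ 2
  D_dvd : ∀ f ∈ discreteInvariants K n ζ, restrict f = 0 → D K n ∣ f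
  coeff_eq_zero : ∀ f ∈ discreteInvariants K n ζ, ∀ k, ¬ m ∣ k → (restrict f).coeff k = 0

/-! ### Invariants on the line a = 0. -/

namespace CovariantData

variable {K : Type*} [Field K] {n : ℕ} {ζ : AlgebraicClosure K} {m : ℕ}

section Invariants

variable (H : CovariantData K n ζ m)
include H

theorem D_ne_zero : D K n ≠ 0 := by
  intro h
  have := H.restrict_pderiv
  rw [h, map_zero, map_zero, eq_comm, neg_eq_zero] at this
  exact pow_ne_zero _ Polynomial.X_ne_zero this

theorem const_ne_zero : (1728 : K) ≠ 0 := by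
  have : (1728 : K) = 2 ^ 6 * 3 ^ 3 := by norm_num
  rw [this]
  exact mul_ne_zero (pow_ne_zero _ H.two_ne) (pow_ne_zero _ H.three_ne)

theorem const_ne_zero' : (1728 : MvPolynomial (Fin 2) K) ≠ 0 := by
  have : (1728 : MvPolynomial (Fin 2) K) = C 1728 := (map_ofNat C 1728).symm
  rw [this]
  exact (map_ne_zero_iff _ (C_injective (Fin 2) K)).2 H.const_ne_zero

theorem exists_eq_D_mul {f : MvPolynomial (Fin 2) K} (hf : f ∈ discreteInvariants K n ζ)
    (h0 : restrict f = 0) : ∃ g ∈ discreteInvariants K n ζ, f = D K n * g := by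
  obtain ⟨g, rfl⟩ := H.D_dvd f hf h0
  exact ⟨g, mem_discreteInvariants_of_mul_mem H.D_ne_zero H.D_mem hf, rfl⟩

/-- The last clause covers degrees below deg D, where k - (m + 2) is truncated to 0. -/
theorem exists_homogeneous_eq_D_mul {f : MvPolynomial (Fin 2) K} {k : ℕ}
    (hf : f ∈ discreteInvariants K n ζ) (hk : f.IsHomogeneous k) (h0 : restrict f = 0) :
    ∃ g ∈ discreteInvariants K n ζ, g.IsHomogeneous (k - (m + 2)) ∧ f = D K n * g ∧
      (k < m + 2 → g = 0) := by
  obtain ⟨g, hg, rfl⟩ := H.exists_eq_D_mul hf h0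
  have h := homogeneousComponent_mul_of_isHomogeneous H.D_hom g k
  rw [homogeneousComponent_eq_self hk] at h
  split_ifs at h with hle
  · exact ⟨_, homogeneousComponent_mem_discreteInvariants hg _,
      homogeneousComponent_isHomogeneous _ _, h, fun h => by omega⟩
  · exact ⟨0, zero_mem _, isHomogeneous_zero _ _ _, by rw [h, mul_zero], fun _ => rfl⟩

theorem eq_zero_of_lt {f : MvPolynomial (Fin 2) K} {k : ℕ} (hf : f ∈ discreteInvariants K n ζ)
    (hk : f.IsHomogeneous k) (h0 : restrict f = 0) (hlt : k < m + 2) : f = 0 := by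
  obtain ⟨g, -, -, rfl, hg⟩ := H.exists_homogeneous_eq_D_mul hf hk h0
  rw [hg hlt, mul_zero]

theorem restrict_eq_zero_of_not_dvd {f : MvPolynomial (Fin 2) K} {k : ℕ}
    (hf : f ∈ discreteInvariants K n ζ) (hk : f.IsHomogeneous k) (hmk : ¬ m ∣ k) :
    restrict f = 0 := by
  rw [restrict_of_isHomogeneous hk, H.coeff_eq_zero f hf k hmk, map_zero, zero_mul]

/-- There is no invariant of degree `m` which is nonzero on the zeros of `D`. -/
theorem restrict_eq_zero_of_isHomogeneous (hm : m = 1 ∨ 3 ≤ n ∧ 4 ≤ m)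
    {f : MvPolynomial (Fin 2) K} (hf : f ∈ discreteInvariants K n ζ) (hk : f.IsHomogeneous m) :
    restrict f = 0 := by
  by_contra hne
  rw [restrict_of_isHomogeneous hk] at hne
  have hc : (restrict f).coeff m ≠ 0 := by
    intro h
    rw [h, map_zero, zero_mul] at hne
    exact hne rfl
  -- After scaling, g restricts to b^m, so on the line g² agrees with c₄ and g³ with -c₆.
  obtain ⟨g, hg, hgm, hgX⟩ : ∃ g ∈ discreteInvariants K n ζ, g.IsHomogeneous m ∧
      restrict g = Polynomial.X ^ m := by
    refine ⟨C ((restrict f).coeff m)⁻¹ * f,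
      mul_mem (Subalgebra.algebraMap_mem _ _) hf, hk.C_mul _, ?_⟩
    rw [map_mul, restrict_of_isHomogeneous hk, ← algebraMap_eq, AlgHom.commutes,
      Polynomial.algebraMap_eq, ← mul_assoc, ← Polynomial.C_mul]
    simp [hc]
  -- The quotient h of g² - c₄ by D has degree m - 2. For m ≥ 4 this is not a multiple of m, so h
  -- vanishes on the line too, and its degree is too small for a further factor D.
  have hsq : g ^ 2 = c4 K n := by
    obtain ⟨h, hh, hhom, he, hlt⟩ := H.exists_homogeneous_eq_D_mul
      (sub_mem (pow_mem hg 2) H.c4_mem)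
      (k := 2 * m) ((by simpa [mul_comm] using hgm.pow 2 : (g ^ 2).IsHomogeneous _).sub H.c4_hom)
      (by rw [map_sub, map_pow, hgX, H.restrict_c4]; ring)
    have h0 : h = 0 := by
      by_cases h1 : 2 * m < m + 2
      · exact hlt h1
      · refine H.eq_zero_of_lt hh hhom (H.restrict_eq_zero_of_not_dvd hh hhom fun hd => ?_)
          (by omega)
        have := Nat.le_of_dvd (by omega) hd
        omega
    rw [h0, mul_zero, sub_eq_zero] at he
    exact he
  obtain ⟨h, hh, hhom, he, hlt⟩ := H.exists_homogeneous_eq_D_mul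
      (add_mem (pow_mem hg 3) H.c6_mem)
      (k := 3 * m) ((by simpa [mul_comm] using hgm.pow 3 : (g ^ 3).IsHomogeneous _).add H.c6_hom)
      (by rw [map_add, map_pow, hgX, H.restrict_c6]; ring)
  -- Write g³ + c₆ = D h; then 1728 Dⁿ = g⁶ - c₆² = D h (D h - 2c₆).
  have key : 1728 * D K n ^ n = D K n ^ 2 * h ^ 2 - 2 * D K n * h * c6 K n := by
    rw [← H.relation, ← hsq]
    linear_combination (g ^ 3 + D K n * h - c6 K n) * he
  obtain ⟨l, rfl⟩ := Nat.exists_eq_add_of_le H.two_le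
  have h2 : (2 : Polynomial K) ≠ 0 := by
    have : (2 : Polynomial K) = Polynomial.C 2 := (map_ofNat Polynomial.C 2).symm
    rw [this]
    exact Polynomial.C_ne_zero.2 H.two_ne
  have hX : (Polynomial.X : Polynomial K) ^ (3 * m) ≠ 0 := pow_ne_zero _ Polynomial.X_ne_zero
  have key1 : 1728 * D K (2 + l) ^ (l + 1) = D K (2 + l) * h ^ 2 - 2 * h * c6 K (2 + l) :=
    mul_left_cancel₀ H.D_ne_zero (by linear_combination key)
  have hr : restrict h = 0 := by
    have := congrArg restrict key1
    simp only [map_mul, map_sub, map_pow, H.restrict_D, H.restrict_c6, map_ofNat] at this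
    have h3 : 2 * Polynomial.X ^ (3 * m) * restrict h = 0 := by linear_combination -this
    exact (mul_eq_zero.1 h3).resolve_left (mul_ne_zero h2 hX)
  obtain ⟨h', hh', hhom', rfl, hlt'⟩ := H.exists_homogeneous_eq_D_mul hh hhom hr
  -- For m = 1, h has degree 0 and cannot contain D. Otherwise n ≥ 3 allows a second cancellation of
  -- D, so h' vanishes on the line, while its degree m - 4 is less than deg D.
  have h'0 : h' = 0 := by
    rcases hm with rfl | ⟨h3, h4⟩
    · exact hlt' (by norm_num)
    · obtain ⟨l, rfl⟩ := Nat.exists_eq_add_of_le' (show 1 ≤ l by omega)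
      have key2 : 1728 * D K (2 + (l + 1)) ^ (l + 1) =
          D K (2 + (l + 1)) ^ 2 * h' ^ 2 - 2 * h' * c6 K (2 + (l + 1)) :=
        mul_left_cancel₀ H.D_ne_zero (by linear_combination key1)
      refine H.eq_zero_of_lt hh' hhom' ?_ (by omega)
      have := congrArg restrict key2
      simp only [map_mul, map_sub, map_pow, H.restrict_D, H.restrict_c6, map_ofNat] at this
      have h3 : 2 * Polynomial.X ^ (3 * m) * restrict h' = 0 := by linear_combination -this
      exact (mul_eq_zero.1 h3).resolve_left (mul_ne_zero h2 hX)
  rw [h'0] at key1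
  have : 1728 * D K (2 + l) ^ (l + 1) = 0 := by linear_combination key1
  exact mul_ne_zero H.const_ne_zero' (pow_ne_zero _ H.D_ne_zero) this

end Invariants

end CovariantData

/-- The substitution `x ↦ c₄`, `y ↦ c₆`. -/
def evalC (K : Type*) [Field K] (n : ℕ) : MvPolynomial (Fin 2) K →ₐ[K] MvPolynomial (Fin 2) K :=
  aeval ![c4 K n, c6 K n]

@[simp] theorem evalC_X_zero (K : Type*) [Field K] (n : ℕ) : evalC K n (X 0) = c4 K n := by
  simp [evalC]

@[simp] theorem evalC_X_one (K : Type*) [Field K] (n : ℕ) : evalC K n (X 1) = c6 K n := by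
  simp [evalC]

/-- `f` is a combination of `1, D, …, D ^ (n - 1)` over `K[c₄, c₆]`. -/
def IsCombination {K : Type*} [Field K] (n : ℕ) (f : MvPolynomial (Fin 2) K) : Prop :=
  ∃ P : ℕ → MvPolynomial (Fin 2) K, f = ∑ i ∈ Finset.range n, evalC K n (P i) * D K n ^ i

/-! ### Independence of the powers of D over K[c₄, c₆]. -/

namespace CovariantData

variable {K : Type*} [Field K] {n : ℕ} {ζ : AlgebraicClosure K} {m : ℕ}

section Invariants

variable (H : CovariantData K n ζ m)
include H

theorem evalC_mem (P : MvPolynomial (Fin 2) K) : evalC K n P ∈ discreteInvariants K n ζ := by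
  induction P using MvPolynomial.induction_on with
  | C a => rw [← algebraMap_eq, AlgHom.commutes]; exact Subalgebra.algebraMap_mem _ _
  | add p q hp hq => rw [map_add]; exact add_mem hp hq
  | mul_X p i hp =>
    rw [map_mul]
    refine mul_mem hp ?_
    fin_cases i
    · simpa using H.c4_mem
    · simpa using H.c6_mem

theorem evalC_cusp : evalC K n (X 0 ^ 3 - X 1 ^ 2) = 1728 * D K n ^ n := by
  simp [H.relation]

theorem restrict_evalC_aeval (p : Polynomial K) :
    restrict (evalC K n (Polynomial.aeval (X 0) p)) = Polynomial.expand K (2 * m) p := by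
  rw [← Polynomial.aeval_algHom_apply, ← Polynomial.aeval_algHom_apply, evalC_X_zero,
    H.restrict_c4, Polynomial.expand_eq_comp_X_pow, Polynomial.comp_eq_aeval]

/-- The normal form restricts to p(b^{2m}) - q(b^{2m}) b^{3m}, and the two terms involve even and
odd multiples of m respectively. -/
theorem cusp_dvd_of_restrict_eq_zero {P : MvPolynomial (Fin 2) K}
    (h : restrict (evalC K n P) = 0) : X 0 ^ 3 - X 1 ^ 2 ∣ P := by
  obtain ⟨p, q, Q, rfl⟩ := exists_cusp_normal_form P
  have hn : n ≠ 0 := by have := H.two_le; omega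
  rw [map_add, map_mul, H.evalC_cusp] at h
  simp only [map_add, map_mul, map_pow, evalC_X_one, H.restrict_D, H.restrict_c6,
    H.restrict_evalC_aeval, zero_pow hn] at h
  obtain ⟨rfl, rfl⟩ := eq_zero_of_expand_eq_expand_mul H.m_pos (p := p) (q := q) (j := 1) (by
    rw [show m * (2 * 1 + 1) = 3 * m by ring]; linear_combination h)
  simp

/-- The terms with i < k contain x³ - y² by induction, hence Dⁿ; those with i > k contain D^{k+1}.
So D divides the value of P k at (c₄, c₆). -/
theorem cusp_dvd_of_sum_eq_zero {P : ℕ → MvPolynomial (Fin 2) K}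
    (h : ∑ i ∈ Finset.range n, evalC K n (P i) * D K n ^ i = 0) {k : ℕ} (hk : k < n) :
    X 0 ^ 3 - X 1 ^ 2 ∣ P k := by
  induction k using Nat.strong_induction_on with
  | _ k ih =>
  apply H.cusp_dvd_of_restrict_eq_zero
  have hrest : D K n ^ (k + 1) ∣
      ∑ i ∈ (Finset.range n).erase k, evalC K n (P i) * D K n ^ i := by
    refine Finset.dvd_sum fun i hi => ?_
    rw [Finset.mem_erase, Finset.mem_range] at hi
    rcases lt_or_gt_of_ne hi.1 with hik | hik
    · obtain ⟨Q, hQ⟩ := ih i hik hi.2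
      rw [hQ, map_mul, H.evalC_cusp]
      exact (((pow_dvd_pow _ (show k + 1 ≤ n from hk)).mul_left _).mul_right _).mul_right _
    · exact (pow_dvd_pow _ (show k + 1 ≤ i from hik)).mul_left _
  rw [← Finset.add_sum_erase _ _ (Finset.mem_range.2 hk)] at h
  have h1 : D K n ^ (k + 1) ∣ evalC K n (P k) * D K n ^ k := (dvd_add_left hrest).1 (h ▸ dvd_zero _)
  rw [pow_succ', mul_dvd_mul_iff_right (pow_ne_zero _ H.D_ne_zero)] at h1
  obtain ⟨g, hg⟩ := h1
  rw [hg, map_mul, H.restrict_D, zero_mul]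

/-- Cancelling 1728 Dⁿ, the value of x³ - y², from all coefficients gives a relation of the same
shape, so the division can be repeated. -/
theorem cusp_pow_dvd_of_sum_eq_zero (N : ℕ) {P : ℕ → MvPolynomial (Fin 2) K}
    (h : ∑ i ∈ Finset.range n, evalC K n (P i) * D K n ^ i = 0) {k : ℕ} (hk : k < n) :
    (X 0 ^ 3 - X 1 ^ 2) ^ N ∣ P k := by
  induction N generalizing P with
  | zero => simp
  | succ N ih =>
    have h1 : ∀ k, ∃ Q, k < n → P k = (X 0 ^ 3 - X 1 ^ 2) * Q := fun k => by
      by_cases hk : k < n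
      · obtain ⟨Q, hQ⟩ := H.cusp_dvd_of_sum_eq_zero h hk
        exact ⟨Q, fun _ => hQ⟩
      · exact ⟨0, fun h => absurd h hk⟩
    choose Q hQ using h1
    rw [hQ k hk, pow_succ']
    refine mul_dvd_mul_left _ (ih (P := Q) ?_)
    have h2 : 1728 * D K n ^ n * ∑ i ∈ Finset.range n, evalC K n (Q i) * D K n ^ i = 0 := by
      rw [← h, Finset.mul_sum]
      refine Finset.sum_congr rfl fun i hi => ?_
      rw [hQ i (Finset.mem_range.1 hi), map_mul, H.evalC_cusp]
      ring
    exact (mul_eq_zero.1 h2).resolve_left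
      (mul_ne_zero H.const_ne_zero' (pow_ne_zero _ H.D_ne_zero))

omit H in
theorem cusp_ne_zero : (X 0 ^ 3 - X 1 ^ 2 : MvPolynomial (Fin 2) K) ≠ 0 := by
  intro h
  have := congrArg (eval ![1, 0]) h
  simp at this

/-- `1, D, …, D ^ (n - 1)` are linearly independent over `K[c₄, c₆]`. -/
theorem eq_zero_of_sum_eq_zero {P : ℕ → MvPolynomial (Fin 2) K}
    (h : ∑ i ∈ Finset.range n, evalC K n (P i) * D K n ^ i = 0) {k : ℕ} (hk : k < n) :
    P k = 0 := by
  by_contra hne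
  have hu : ¬ IsUnit (X 0 ^ 3 - X 1 ^ 2 : MvPolynomial (Fin 2) K) := fun hu => by
    have := hu.map (eval (0 : Fin 2 → K))
    simp at this
  obtain ⟨N, hN⟩ := FiniteMultiplicity.of_not_isUnit hu hne
  exact hN (H.cusp_pow_dvd_of_sum_eq_zero _ h hk)

/-- The product of D with n - 1 terms involves D, …, D^{n-1}, so each power of D below the nth
occurs once. -/
theorem eq_zero_of_add_sum_eq_zero {P : MvPolynomial (Fin 2) K}
    {Q : Fin (n - 1) → MvPolynomial (Fin 2) K}
    (h : evalC K n P + D K n * ∑ i, evalC K n (Q i) * D K n ^ (i : ℕ) = 0) :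
    P = 0 ∧ ∀ i, Q i = 0 := by
  let P' : ℕ → MvPolynomial (Fin 2) K := fun i =>
    match i with
    | 0 => P
    | j + 1 => if h : j < n - 1 then Q ⟨j, h⟩ else 0
  have h0 : P' 0 = P := rfl
  have hQ : ∀ i : Fin (n - 1), P' (i + 1) = Q i := fun i => dif_pos i.2
  have hsum : ∑ i ∈ Finset.range n, evalC K n (P' i) * D K n ^ i = 0 := by
    have hn : n = (n - 1) + 1 := by have := H.two_le; omega
    have : Finset.range n = Finset.range ((n - 1) + 1) := by rw [← hn]
    rw [this, Finset.sum_range_succ', Finset.sum_range, h0, ← h, Finset.mul_sum, add_comm,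
      pow_zero, mul_one]
    exact congrArg (evalC K n P + ·) (Finset.sum_congr rfl fun i _ => by rw [hQ]; ring)
  have := H.two_le
  refine ⟨H.eq_zero_of_sum_eq_zero hsum (k := 0) (by omega), fun i => ?_⟩
  rw [← hQ]
  exact H.eq_zero_of_sum_eq_zero hsum (k := i + 1) (by omega)

/-! ### The ring of invariants -/

omit H in
theorem isCombination_add {f g : MvPolynomial (Fin 2) K} (hf : IsCombination n f)
    (hg : IsCombination n g) : IsCombination n (f + g) := by
  obtain ⟨P, rfl⟩ := hf
  obtain ⟨Q, rfl⟩ := hg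
  refine ⟨P + Q, ?_⟩
  rw [← Finset.sum_add_distrib]
  exact Finset.sum_congr rfl fun i _ => by rw [Pi.add_apply, map_add, add_mul]

theorem isCombination_evalC (Q : MvPolynomial (Fin 2) K) : IsCombination n (evalC K n Q) := by
  have hn := H.two_le
  refine ⟨fun i => if i = 0 then Q else 0, ?_⟩
  rw [Finset.sum_eq_single_of_mem 0 (Finset.mem_range.2 (by omega))
    fun i _ hi => by beta_reduce; rw [if_neg hi, map_zero, zero_mul]]
  simp

/-- The coefficients shift by one place, and the top one returns to place 0 through Dⁿ = (c₄³ -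
c₆²)/1728. -/
theorem isCombination_D_mul {f : MvPolynomial (Fin 2) K} (hf : IsCombination n f) :
    IsCombination n (D K n * f) := by
  obtain ⟨P, rfl⟩ := hf
  have hn := H.two_le
  have e : evalC K n (C (1728⁻¹)) * 1728 = 1 := by
    rw [← algebraMap_eq, AlgHom.commutes, algebraMap_eq,
      ← map_ofNat (C (σ := Fin 2) (R := K)) 1728, ← C_mul, inv_mul_cancel₀ H.const_ne_zero, C_1]
  obtain ⟨l, hl⟩ := Nat.exists_eq_add_of_le' (show 1 ≤ n by omega)
  have hrange : Finset.range n = Finset.range (l + 1) := by rw [← hl]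
  refine ⟨fun i => match i with
    | 0 => C (1728⁻¹) * (X 0 ^ 3 - X 1 ^ 2) * P l
    | j + 1 => P j, ?_⟩
  rw [hrange, Finset.sum_range_succ _ l, Finset.sum_range_succ' _ l, mul_add, Finset.mul_sum]
  have h1 : D K n * (evalC K n (P l) * D K n ^ l) =
      evalC K n (C (1728⁻¹) * (X 0 ^ 3 - X 1 ^ 2) * P l) * D K n ^ 0 := by
    rw [map_mul, map_mul, H.evalC_cusp]
    have : D K n ^ n = D K n ^ l * D K n := by rw [← pow_succ, ← hl]
    rw [this]
    linear_combination -evalC K n (P l) * D K n ^ l * D K n * e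
  rw [h1]
  exact congrArg (· + _) (Finset.sum_congr rfl fun i _ => by ring)

/-- On the line the invariant is matched by a multiple of a monomial in c₄, c₆; the difference is D
times an invariant of lower degree. -/
theorem isCombination_of_isHomogeneous
    (hgap : ∀ f ∈ discreteInvariants K n ζ, f.IsHomogeneous m → restrict f = 0) (k : ℕ)
    {f : MvPolynomial (Fin 2) K} (hf : f ∈ discreteInvariants K n ζ) (hk : f.IsHomogeneous k) :
    IsCombination n f := by
  induction k using Nat.strong_induction_on generalizing f with
  | _ k ih =>
  have hdvd : ∀ f ∈ discreteInvariants K n ζ, f.IsHomogeneous k → restrict f = 0 →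
      IsCombination n f := by
    intro f hf hk hr
    obtain ⟨g, hg, hgk, rfl, hlt⟩ := H.exists_homogeneous_eq_D_mul hf hk hr
    by_cases hkm : k < m + 2
    · exact ⟨0, by simp [hlt hkm]⟩
    · exact H.isCombination_D_mul (ih (k - (m + 2)) (by omega) hg hgk)
  by_cases hr : restrict f = 0
  · exact hdvd f hf hk hr
  have hmk : m ∣ k := by
    by_contra h
    exact hr (H.restrict_eq_zero_of_not_dvd hf hk h)
  obtain ⟨q, rfl⟩ := hmk
  have hq : q ≠ 1 := by
    rintro rfl
    exact hr (hgap f hf (by rwa [mul_one] at hk))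
  -- Every natural number except 1 has this form; in the odd case q ≠ 1 makes i - 1 an honest
  -- subtraction.
  obtain ⟨i, j, hij⟩ : ∃ i j, q = 2 * i + 3 * j := by
    rcases Nat.even_or_odd' q with ⟨i, rfl | rfl⟩
    · exact ⟨i, 0, by ring⟩
    · exact ⟨i - 1, 1, by omega⟩
  obtain ⟨r, hrX⟩ : ∃ r, restrict f = Polynomial.C r * Polynomial.X ^ (m * q) :=
    ⟨_, restrict_of_isHomogeneous hk⟩
  -- The sign (-1)^j compensates for c₆ restricting to -b^{3m}.
  let Q : MvPolynomial (Fin 2) K := C (r * (-1) ^ j) * X 0 ^ i * X 1 ^ j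
  have hQ : evalC K n Q = C (r * (-1) ^ j) * c4 K n ^ i * c6 K n ^ j := by
    rw [map_mul, map_mul, map_pow, map_pow, evalC_X_zero, evalC_X_one, ← algebraMap_eq,
      AlgHom.commutes]
  have hQk : (evalC K n Q).IsHomogeneous (m * q) := by
    rw [hQ, hij]
    have := ((H.c4_hom.pow i).mul (H.c6_hom.pow j)).C_mul (r * (-1) ^ j)
    rw [← mul_assoc] at this
    convert! this using 1
    ring
  have hQX : restrict (evalC K n Q) = Polynomial.C r * Polynomial.X ^ (m * q) := by
    rw [hQ, map_mul, map_mul, map_pow, map_pow, H.restrict_c4, H.restrict_c6,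
      ← algebraMap_eq, AlgHom.commutes, Polynomial.algebraMap_eq, hij, Polynomial.C_mul,
      Polynomial.C_pow, Polynomial.C_neg, Polynomial.C_1,
      neg_pow (Polynomial.X ^ (3 * m) : Polynomial K) j]
    have h1 : ((-1 : Polynomial K) ^ j) * (-1) ^ j = 1 := by
      rw [← mul_pow, neg_one_mul, neg_neg, one_pow]
    have h2 : (Polynomial.X : Polynomial K) ^ (m * (2 * i + 3 * j)) =
        (Polynomial.X ^ (2 * m)) ^ i * (Polynomial.X ^ (3 * m)) ^ j := by
      rw [← pow_mul, ← pow_mul, ← pow_add]; congr 1; ring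
    rw [h2]
    linear_combination
      Polynomial.C r * (Polynomial.X ^ (2 * m)) ^ i * (Polynomial.X ^ (3 * m)) ^ j * h1
  rw [← sub_add_cancel f (evalC K n Q)]
  exact isCombination_add (hdvd _ (sub_mem hf (H.evalC_mem Q)) (hk.sub hQk)
    (by rw [map_sub, hQX, hrX, sub_self])) (H.isCombination_evalC Q)

/-- The invariants are combinations of `1, D, …, D ^ (n - 1)` over `K[c₄, c₆]`. -/
theorem isCombination_of_mem
    (hgap : ∀ f ∈ discreteInvariants K n ζ, f.IsHomogeneous m → restrict f = 0)
    {f : MvPolynomial (Fin 2) K} (hf : f ∈ discreteInvariants K n ζ) : IsCombination n f := by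
  rw [← sum_homogeneousComponent f]
  refine Finset.sum_induction _ (IsCombination n) (fun _ _ => isCombination_add) ⟨0, by simp⟩
    fun k _ => ?_
  exact H.isCombination_of_isHomogeneous hgap k
    (homogeneousComponent_mem_discreteInvariants hf k) (homogeneousComponent_isHomogeneous k f)

/-- Each invariant is `p(c₄) + q(c₄) c₆` modulo `D`. -/
theorem exists_eq_add_D_mul
    (hgap : ∀ f ∈ discreteInvariants K n ζ, f.IsHomogeneous m → restrict f = 0)
    {f : MvPolynomial (Fin 2) K} (hf : f ∈ discreteInvariants K n ζ) :
    ∃ (p q : Polynomial K), ∃ g ∈ discreteInvariants K n ζ,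
      f = evalC K n (Polynomial.aeval (X 0) p) + evalC K n (Polynomial.aeval (X 0) q) * c6 K n +
        D K n * g := by
  have hn := H.two_le
  obtain ⟨P, hP⟩ := H.isCombination_of_mem hgap hf
  obtain ⟨p, q, Q, hQ⟩ := exists_cusp_normal_form (P 0)
  have hr : restrict (f - (evalC K n (Polynomial.aeval (X 0) p) +
      evalC K n (Polynomial.aeval (X 0) q) * c6 K n)) = 0 := by
    obtain ⟨l, hl⟩ := Nat.exists_eq_add_of_le' (show 1 ≤ n by omega)
    have hrange : Finset.range n = Finset.range (l + 1) := by rw [← hl]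
    rw [hP, hrange, Finset.sum_range_succ', hQ]
    simp only [map_sub, map_add, map_mul, H.evalC_cusp, map_sum, map_pow, H.restrict_D, evalC_X_one,
      zero_pow (Nat.succ_ne_zero _), zero_pow (show n ≠ 0 by omega)]
    simp
  obtain ⟨g, hg, he⟩ := H.exists_eq_D_mul (sub_mem hf (add_mem (H.evalC_mem _)
    (mul_mem (H.evalC_mem _) H.c6_mem))) hr
  exact ⟨p, q, g, hg, by linear_combination he⟩

end Invariants

end CovariantData

/-! ### Covariants from invariants, and the coefficients in K[c₄, c₆]. -/

section Covariants

variable {K : Type*} [Field K] {n : ℕ} {ζ : AlgebraicClosure K}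

/-- By the chain rule the gradient transforms by the inverse transpose of γ; a quarter turn carries
the inverse transpose of a matrix of determinant 1 to the matrix itself. -/
theorem del_mem_discreteCovariants {f : MvPolynomial (Fin 2) K}
    (hf : f ∈ discreteInvariants K n ζ) : del f ∈ discreteCovariants K n ζ := by
  intro γ hγ v
  have h : ∀ j, aeval v (pderiv j f) = γ.1 0 j * aeval (γ.1.mulVec v) (pderiv 0 f) +
      γ.1 1 j * aeval (γ.1.mulVec v) (pderiv 1 f) := by
    intro j
    have h1 := pderiv_subst γ.1 (map (algebraMap K (AlgebraicClosure K)) f) j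
    rw [subst_map_of_mem hf ⟨γ, hγ, rfl⟩, pderiv_map, pderiv_map, pderiv_map] at h1
    have h2 := congrArg (eval v) h1
    simp only [map_add, map_mul, eval_C, eval_subst, eval_map] at h2
    exact h2
  have hdet : γ.1 0 0 * γ.1 1 1 - γ.1 0 1 * γ.1 1 0 = 1 := by
    rw [← Matrix.det_fin_two]; exact γ.2
  have hmul : ∀ w i, γ.1.mulVec w i = γ.1 i 0 * w 0 + γ.1 i 1 * w 1 := fun w i => by
    rw [Matrix.mulVec, dotProduct, Fin.sum_univ_two]
  ext i
  rw [hmul]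
  fin_cases i
  · simp only [evalPair, del, Fin.zero_eta, Matrix.cons_val_zero, Matrix.cons_val_one, map_neg, h]
    linear_combination (aeval (γ.1.mulVec v) (pderiv 1 f)) * hdet
  · simp only [evalPair, del, Fin.mk_one, Matrix.cons_val_zero, Matrix.cons_val_one, map_neg, h]
    linear_combination -(aeval (γ.1.mulVec v) (pderiv 0 f)) * hdet

theorem U_mem_discreteCovariants : U K ∈ discreteCovariants K n ζ := by
  have h : ∀ v : Fin 2 → AlgebraicClosure K, evalPair (U K) v = v := fun v => by
    ext i; fin_cases i <;> simp [evalPair, U]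
  intro γ _ v
  rw [h, h]

theorem smul_mem_discreteCovariants {f : MvPolynomial (Fin 2) K}
    (hf : f ∈ discreteInvariants K n ζ) {p : Fin 2 → MvPolynomial (Fin 2) K}
    (hp : p ∈ discreteCovariants K n ζ) : f • p ∈ discreteCovariants K n ζ :=
  Submodule.smul_mem (discreteCovariants K n ζ) (⟨f, hf⟩ : discreteInvariants K n ζ) hp

/-- The determinant of two covariants is an invariant. -/
theorem det_mem_discreteInvariants {p q : Fin 2 → MvPolynomial (Fin 2) K}
    (hp : p ∈ discreteCovariants K n ζ) (hq : q ∈ discreteCovariants K n ζ) :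
    p 0 * q 1 - p 1 * q 0 ∈ discreteInvariants K n ζ := by
  intro γ hγ v
  have hdet : γ.1 0 0 * γ.1 1 1 - γ.1 0 1 * γ.1 1 0 = 1 := by
    rw [← Matrix.det_fin_two]; exact γ.2
  have h : ∀ {p : Fin 2 → MvPolynomial (Fin 2) K}, p ∈ discreteCovariants K n ζ → ∀ i,
      aeval (γ.1.mulVec v) (p i) = γ.1 i 0 * aeval v (p 0) + γ.1 i 1 * aeval v (p 1) := by
    intro p hp i
    have := congrFun (hp γ hγ v) i
    simpa only [evalPair, Matrix.mulVec, dotProduct, Fin.sum_univ_two] using this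
  simp only [map_sub, map_mul, h hp, h hq]
  linear_combination (aeval v (p 0) * aeval v (q 1) - aeval v (p 1) * aeval v (q 0)) * hdet

variable {h4 : c4 K n ∈ discreteInvariants K n ζ} {h6 : c6 K n ∈ discreteInvariants K n ζ}

theorem coe_aeval_eq_evalC (P : MvPolynomial (Fin 2) K) :
    ((aeval (![⟨c4 K n, h4⟩, ⟨c6 K n, h6⟩] : Fin 2 → discreteInvariants K n ζ) P :
      discreteInvariants K n ζ) : MvPolynomial (Fin 2) K) = evalC K n P := by
  have : (discreteInvariants K n ζ).val.comp
      (aeval (![⟨c4 K n, h4⟩, ⟨c6 K n, h6⟩] : Fin 2 → discreteInvariants K n ζ)) =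
      evalC K n := by
    ext i : 1
    fin_cases i <;> simp
  exact congrArg (fun g => g P) this

theorem ringC4C6_eq_range : ringC4C6 K n ζ h4 h6 =
    (aeval (![⟨c4 K n, h4⟩, ⟨c6 K n, h6⟩] : Fin 2 → discreteInvariants K n ζ)).range := by
  rw [ringC4C6, ← Algebra.adjoin_range_eq_range_aeval, Matrix.range_cons, Matrix.range_cons,
    Matrix.range_empty, Set.union_empty]
  rfl

theorem exists_coe_eq_evalC (P : MvPolynomial (Fin 2) K) :
    ∃ c : ringC4C6 K n ζ h4 h6, (c.1.1 : MvPolynomial (Fin 2) K) = evalC K n P :=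
  ⟨⟨aeval (![⟨c4 K n, h4⟩, ⟨c6 K n, h6⟩] : Fin 2 → discreteInvariants K n ζ) P, by
    rw [ringC4C6_eq_range]; exact ⟨P, rfl⟩⟩, coe_aeval_eq_evalC P⟩

theorem exists_evalC_eq_coe (c : ringC4C6 K n ζ h4 h6) :
    ∃ P, (c.1.1 : MvPolynomial (Fin 2) K) = evalC K n P := by
  obtain ⟨c, hc⟩ := c
  rw [ringC4C6_eq_range] at hc
  obtain ⟨P, rfl⟩ := hc
  exact ⟨P, coe_aeval_eq_evalC P⟩

end Covariants

/-! ### Relations among U, ∂D, ∂c₄ and ∂c₆. -/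

namespace CovariantData

variable {K : Type*} [Field K] {n : ℕ} {ζ : AlgebraicClosure K} {m : ℕ}

section

variable (H : CovariantData K n ζ m)
include H

theorem C_inv_mul_eq_one : (C (m + 2 : K)⁻¹ : MvPolynomial (Fin 2) K) * (m + 2) = 1 := by
  have : (m + 2 : MvPolynomial (Fin 2) K) = C (m + 2 : K) := by
    rw [C_add, map_natCast, map_ofNat]
  rw [this, ← C_mul, inv_mul_cancel₀ H.m_add_two_ne, C_1]

theorem euler_D : X 0 * pderiv 0 (D K n) + X 1 * pderiv 1 (D K n) =
    ((m : MvPolynomial (Fin 2) K) + 2) * D K n := by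
  have := H.D_hom.sum_X_mul_pderiv
  rw [Fin.sum_univ_two, nsmul_eq_mul] at this
  exact_mod_cast this

theorem euler_c4 : X 0 * pderiv 0 (c4 K n) + X 1 * pderiv 1 (c4 K n) =
    (2 * (m : MvPolynomial (Fin 2) K)) * c4 K n := by
  have := H.c4_hom.sum_X_mul_pderiv
  rw [Fin.sum_univ_two, nsmul_eq_mul] at this
  exact_mod_cast this

theorem euler_c6 : X 0 * pderiv 0 (c6 K n) + X 1 * pderiv 1 (c6 K n) =
    (3 * (m : MvPolynomial (Fin 2) K)) * c6 K n := by
  have := H.c6_hom.sum_X_mul_pderiv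
  rw [Fin.sum_univ_two, nsmul_eq_mul] at this
  exact_mod_cast this

/-- Cramer's rule for the covariants `U` and `∂D`. -/
theorem D_mul_eq (p : Fin 2 → MvPolynomial (Fin 2) K) (j : Fin 2) :
    D K n * p j = C (m + 2 : K)⁻¹ * (p 0 * del (D K n) 1 - p 1 * del (D K n) 0) * U K j +
      C (m + 2 : K)⁻¹ * (U K 0 * p 1 - U K 1 * p 0) * del (D K n) j := by
  fin_cases j
  · simp only [Fin.zero_eta, U, del, Matrix.cons_val_zero, Matrix.cons_val_one]
    linear_combination (-D K n * p 0) * H.C_inv_mul_eq_one -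
      C (m + 2 : K)⁻¹ * p 0 * H.euler_D
  · simp only [Fin.mk_one, U, del, Matrix.cons_val_zero, Matrix.cons_val_one]
    linear_combination (-D K n * p 1) * H.C_inv_mul_eq_one -
      C (m + 2 : K)⁻¹ * p 1 * H.euler_D

/-- Of the two determinants in Cramer's rule, one is the Jacobian of D and c₄, a multiple of c₆, and
the other is Euler's expression for c₄. The same works for c₆. -/
theorem D_mul_del_c4 (j : Fin 2) : D K n * del (c4 K n) j =
    C (2 * m / (m + 2) : K) * (-c6 K n * U K j + c4 K n * del (D K n) j) := by
  have hC : (C (2 * m / (m + 2) : K) : MvPolynomial (Fin 2) K) =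
      2 * (m : MvPolynomial (Fin 2) K) * C (m + 2 : K)⁻¹ := by
    rw [div_eq_mul_inv, C_mul, C_mul, map_natCast, map_ofNat]
  have h1 := H.jacobian_c4
  have h2 := H.euler_c4
  push_cast at h1
  rw [H.D_mul_eq, hC]
  simp only [U, del, Matrix.cons_val_zero, Matrix.cons_val_one]
  linear_combination -C (m + 2 : K)⁻¹ * ![X 0, X 1] j * h1 +
    C (m + 2 : K)⁻¹ * ![-pderiv 1 (D K n), pderiv 0 (D K n)] j * h2

theorem D_mul_del_c6 (j : Fin 2) : D K n * del (c6 K n) j =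
    C (3 * m / (m + 2) : K) * (-c4 K n ^ 2 * U K j + c6 K n * del (D K n) j) := by
  have hC : (C (3 * m / (m + 2) : K) : MvPolynomial (Fin 2) K) =
      3 * (m : MvPolynomial (Fin 2) K) * C (m + 2 : K)⁻¹ := by
    rw [div_eq_mul_inv, C_mul, C_mul, map_natCast, map_ofNat]
  have h1 := H.jacobian_c6
  have h2 := H.euler_c6
  push_cast at h1
  rw [H.D_mul_eq, hC]
  simp only [U, del, Matrix.cons_val_zero, Matrix.cons_val_one]
  linear_combination -C (m + 2 : K)⁻¹ * ![X 0, X 1] j * h1 +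
    C (m + 2 : K)⁻¹ * ![-pderiv 1 (D K n), pderiv 0 (D K n)] j * h2

omit H in
theorem exists_C_mul_eq_one {k : K} (hk : k ≠ 0) :
    ∃ l : K, l ≠ 0 ∧ (C l : MvPolynomial (Fin 2) K) * C k = 1 :=
  ⟨k⁻¹, inv_ne_zero hk, by rw [← C_mul, inv_mul_cancel₀ hk, C_1]⟩

theorem const_c4_ne_zero : (2 * m / (m + 2) : K) ≠ 0 :=
  div_ne_zero (mul_ne_zero H.two_ne H.m_ne) H.m_add_two_ne

theorem const_c6_ne_zero : (3 * m / (m + 2) : K) ≠ 0 :=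
  div_ne_zero (mul_ne_zero H.three_ne H.m_ne) H.m_add_two_ne

omit H in
@[simp] theorem evalC_C (k : K) : evalC K n (C k) = C k := by
  rw [← algebraMap_eq, AlgHom.commutes]

/-- Up to constants, D ∂c₄ and D ∂c₆ are given in terms of U, ∂D by a matrix of determinant c₄³ -
c₆² = 1728 Dⁿ. The witnesses are the entries of its adjugate, scaled; one factor D cancels. -/
theorem exists_D_pow_mul_eq : ∃ P Q R S : MvPolynomial (Fin 2) K, ∀ j,
    D K n ^ (n - 1) * U K j = evalC K n P * del (c4 K n) j + evalC K n Q * del (c6 K n) j ∧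
    D K n ^ (n - 1) * del (D K n) j =
      evalC K n R * del (c4 K n) j + evalC K n S * del (c6 K n) j := by
  obtain ⟨a, -, ha⟩ := exists_C_mul_eq_one H.const_c4_ne_zero
  obtain ⟨b, -, hb⟩ := exists_C_mul_eq_one H.const_c6_ne_zero
  obtain ⟨d, -, hd⟩ := exists_C_mul_eq_one H.const_ne_zero
  have hpow : D K n * D K n ^ (n - 1) = D K n ^ n := by
    rw [← pow_succ']
    congr 1
    have := H.two_le
    omega
  have hrel : D K n ^ n = C d * (c4 K n ^ 3 - c6 K n ^ 2) := by
    rw [H.relation]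
    rw [map_ofNat] at hd
    linear_combination -D K n ^ n * hd
  refine ⟨C d * C a * X 1, -C d * C b * X 0, C d * C a * X 0 ^ 2, -C d * C b * X 1,
    fun j => ⟨mul_left_cancel₀ H.D_ne_zero ?_, mul_left_cancel₀ H.D_ne_zero ?_⟩⟩
  all_goals
    simp only [map_mul, map_neg, map_pow, evalC_X_zero, evalC_X_one, evalC_C]
    rw [← mul_assoc, hpow, hrel]
    have h4 := H.D_mul_del_c4 j
    have h6 := H.D_mul_del_c6 j
  · linear_combination -C d * C a * c6 K n * h4 + C d * C b * c4 K n * h6 -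
      C d * c6 K n * (-c6 K n * U K j + c4 K n * del (D K n) j) * ha +
      C d * c4 K n * (-c4 K n ^ 2 * U K j + c6 K n * del (D K n) j) * hb
  · linear_combination -C d * C a * c4 K n ^ 2 * h4 + C d * C b * c6 K n * h6 -
      C d * c4 K n ^ 2 * (-c6 K n * U K j + c4 K n * del (D K n) j) * ha +
      C d * c6 K n * (-c4 K n ^ 2 * U K j + c6 K n * del (D K n) j) * hb

/-- A covariant is a combination of `∂c₄`, `∂c₆` over `K[c₄, c₆]` and of `U`, `∂D` over the ring
of invariants. -/
theorem exists_eq_of_mem_discreteCovariants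
    (hgap : ∀ f ∈ discreteInvariants K n ζ, f.IsHomogeneous m → restrict f = 0)
    {p : Fin 2 → MvPolynomial (Fin 2) K} (hp : p ∈ discreteCovariants K n ζ) :
    ∃ P Q : MvPolynomial (Fin 2) K, ∃ f ∈ discreteInvariants K n ζ,
      ∃ g ∈ discreteInvariants K n ζ, ∀ j, p j = evalC K n P * del (c4 K n) j +
        evalC K n Q * del (c6 K n) j + f * U K j + g * del (D K n) j := by
  obtain ⟨a, -, ha⟩ := exists_C_mul_eq_one H.const_c4_ne_zero
  obtain ⟨b, -, hb⟩ := exists_C_mul_eq_one H.const_c6_ne_zero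
  have hp' := H.D_mul_eq p
  have hA := mul_mem (Subalgebra.algebraMap_mem (discreteInvariants K n ζ) (m + 2 : K)⁻¹)
    (det_mem_discreteInvariants hp (del_mem_discreteCovariants H.D_mem))
  have hB := mul_mem (Subalgebra.algebraMap_mem (discreteInvariants K n ζ) (m + 2 : K)⁻¹)
    (det_mem_discreteInvariants (U_mem_discreteCovariants (ζ := ζ)) hp)
  rw [algebraMap_eq] at hA hB
  -- Only the classes of A and B modulo D are constrained; the parts f and g become the coefficients
  -- of U and ∂D.
  obtain ⟨p0, p1, f, hf, hpf⟩ := H.exists_eq_add_D_mul hgap hA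
  obtain ⟨q0, q1, g, hg, hqg⟩ := H.exists_eq_add_D_mul hgap hB
  rw [hpf, hqg] at hp'
  -- In the second coordinate, on a = 0, D vanishes, U becomes b and ∂D becomes -b^{m+1}.
  have hr := congrArg restrict (hp' 1)
  simp only [U, del, Matrix.cons_val_one, Matrix.cons_val_zero, map_mul, map_add, H.restrict_D,
    H.restrict_evalC_aeval, H.restrict_c6, H.restrict_pderiv, restrict_X_one] at hr
  have hr' : Polynomial.expand K (2 * m) (p0 + Polynomial.X ^ 2 * q1) =
      Polynomial.expand K (2 * m) (q0 + Polynomial.X * p1) *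
        Polynomial.X ^ (m * (2 * 0 + 1)) := by
    refine mul_left_cancel₀ (Polynomial.X_ne_zero (R := K)) ?_
    simp only [map_add, map_mul, map_pow, Polynomial.expand_X]
    linear_combination -hr
  -- Thus p0 = -X² q1 and q0 = -X p1, so modulo D the right-hand side is -p1(c₄)(-c₆ U + c₄ ∂D) +
  -- q1(c₄)(-c₄² U + c₆ ∂D), a combination of D ∂c₄ and D ∂c₆.
  obtain ⟨hp0, hq0⟩ := eq_zero_of_expand_eq_expand_mul H.m_pos hr'
  rw [eq_neg_of_add_eq_zero_left hp0, eq_neg_of_add_eq_zero_left hq0] at hp'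
  refine ⟨-C a * Polynomial.aeval (X 0) p1, C b * Polynomial.aeval (X 0) q1, f, hf, g, hg,
    fun j => mul_left_cancel₀ H.D_ne_zero ?_⟩
  rw [hp' j]
  simp only [map_mul, map_neg, map_pow, Polynomial.aeval_X, evalC_X_zero, evalC_C]
  have h4 := H.D_mul_del_c4 j
  have h6 := H.D_mul_del_c6 j
  set α := evalC K n (Polynomial.aeval (X 0) p1)
  set β := evalC K n (Polynomial.aeval (X 0) q1)
  linear_combination C a * α * h4 - C b * β * h6 +
    α * (-c6 K n * U K j + c4 K n * del (D K n) j) * ha -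
    β * (-c4 K n ^ 2 * U K j + c6 K n * del (D K n) j) * hb

/-! ### The basis -/

omit H in
/-- The covariants which form the basis. -/
def basisFamily (H : CovariantData K n ζ m) :
    Fin (n - 1) ⊕ Fin (n - 1) ⊕ Fin 2 → discreteCovariants K n ζ :=
  Sum.elim (fun i => ⟨D K n ^ (i : ℕ) • U K,
      smul_mem_discreteCovariants (pow_mem H.D_mem _) U_mem_discreteCovariants⟩)
    (Sum.elim (fun i => ⟨D K n ^ (i : ℕ) • del (D K n),
        smul_mem_discreteCovariants (pow_mem H.D_mem _) (del_mem_discreteCovariants H.D_mem)⟩)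
      ![⟨del (c4 K n), del_mem_discreteCovariants H.c4_mem⟩,
        ⟨del (c6 K n), del_mem_discreteCovariants H.c6_mem⟩])

theorem linearIndependent_basisFamily :
    LinearIndependent (ringC4C6 K n ζ H.c4_mem H.c6_mem) H.basisFamily := by
  refine (Fintype.linearIndependent_iff (R := ringC4C6 K n ζ H.c4_mem H.c6_mem)
    (v := H.basisFamily)).2 ?_
  intro c hc
  choose P hP using fun i => exists_evalC_eq_coe (c i)
  have hzero : ∀ i, P i = 0 → c i = 0 := fun i hi => by
    apply Subtype.ext
    apply Subtype.ext
    rw [hP, hi, map_zero]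
    rfl
  have hcoe : ∀ j, ∑ i, evalC K n (P i) * (H.basisFamily i).1 j = 0 := fun j => by
    have := congrArg (fun x : discreteCovariants K n ζ => x.1 j) hc
    simp only [Submodule.coe_sum, Finset.sum_apply] at this
    exact (Finset.sum_congr rfl fun i _ => by rw [← hP i]; rfl).trans this
  set A := ∑ i, evalC K n (P (.inl i)) * D K n ^ (i : ℕ) with hA
  set B := ∑ i, evalC K n (P (.inr (.inl i))) * D K n ^ (i : ℕ) with hB
  set α := P (.inr (.inr 0))
  set β := P (.inr (.inr 1))
  have hsum : ∀ j, A * U K j + B * del (D K n) j + evalC K n α * del (c4 K n) j +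
      evalC K n β * del (c6 K n) j = 0 := fun j => by
    have := hcoe j
    rw [Fintype.sum_sum_type, Fintype.sum_sum_type, Fin.sum_univ_two] at this
    rw [← this, hA, hB, Finset.sum_mul, Finset.sum_mul]
    simp only [basisFamily, Sum.elim_inl, Sum.elim_inr, Pi.smul_apply, smul_eq_mul, mul_assoc,
      add_assoc]
    rfl
  set κ : MvPolynomial (Fin 2) K := C (2 * m / (m + 2) : K) with hκ
  set μ : MvPolynomial (Fin 2) K := C (3 * m / (m + 2) : K) with hμ
  have hκ0 : κ ≠ 0 := (map_ne_zero_iff _ (C_injective _ _)).2 H.const_c4_ne_zero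
  have hμ0 : μ ≠ 0 := (map_ne_zero_iff _ (C_injective _ _)).2 H.const_c6_ne_zero
  have hκC : evalC K n κ = κ := evalC_C _
  have hμC : evalC K n μ = μ := evalC_C _
  -- Multiplying the relation by D and replacing D ∂c₄, D ∂c₆ leaves f U + g ∂D = 0. Since det(U,
  -- ∂D) = (m + 2) D is nonzero, f = g = 0.
  set f := evalC K n (-κ * X 1 * α - μ * X 0 ^ 2 * β) + D K n * A with hf
  set g := evalC K n (κ * X 0 * α + μ * X 1 * β) + D K n * B with hg
  have hfg : ∀ j, f * U K j + g * del (D K n) j = 0 := fun j => by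
    simp only [hf, hg, map_add, map_sub, map_neg, map_mul, map_pow, evalC_X_zero, evalC_X_one,
      hκC, hμC]
    linear_combination D K n * hsum j - evalC K n α * H.D_mul_del_c4 j -
      evalC K n β * H.D_mul_del_c6 j
  have h0 := hfg 0
  have h1 := hfg 1
  simp only [U, del, Matrix.cons_val_zero, Matrix.cons_val_one] at h0 h1
  have hm0 : (m + 2 : MvPolynomial (Fin 2) K) ≠ 0 := fun h => by
    have := H.C_inv_mul_eq_one
    rw [h, mul_zero] at this
    exact zero_ne_one this
  have hmD := mul_ne_zero hm0 H.D_ne_zero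
  have hf0 : f = 0 := by
    refine (mul_eq_zero.1 (?_ : ((m + 2 : MvPolynomial (Fin 2) K) * D K n) * f = 0)).resolve_left
      hmD
    rw [← H.euler_D]
    linear_combination pderiv 0 (D K n) * h0 + pderiv 1 (D K n) * h1
  have hg0 : g = 0 := by
    refine (mul_eq_zero.1 (?_ : ((m + 2 : MvPolynomial (Fin 2) K) * D K n) * g = 0)).resolve_left
      hmD
    rw [← H.euler_D]
    linear_combination X 0 * h1 - X 1 * h0
  obtain ⟨e1, hPA⟩ := H.eq_zero_of_add_sum_eq_zero hf0
  obtain ⟨e2, hPB⟩ := H.eq_zero_of_add_sum_eq_zero hg0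
  -- The system `e1`, `e2` in α, β has determinant κμ(x³ - y²).
  have hα : α = 0 := by
    refine (mul_eq_zero.1 (?_ : κ * (X 0 ^ 3 - X 1 ^ 2) * α = 0)).resolve_left
      (mul_ne_zero hκ0 cusp_ne_zero)
    linear_combination X 1 * e1 + X 0 ^ 2 * e2
  have hβ : β = 0 := by
    refine (mul_eq_zero.1 (?_ : μ * (X 0 ^ 3 - X 1 ^ 2) * β = 0)).resolve_left
      (mul_ne_zero hμ0 cusp_ne_zero)
    linear_combination -X 0 * e1 - X 1 * e2
  rintro (i | i | i)
  · exact hzero _ (hPA i)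
  · exact hzero _ (hPB i)
  · fin_cases i
    · exact hzero _ hα
    · exact hzero _ hβ

theorem span_basisFamily
    (hgap : ∀ f ∈ discreteInvariants K n ζ, f.IsHomogeneous m → restrict f = 0) :
    ⊤ ≤ Submodule.span (ringC4C6 K n ζ H.c4_mem H.c6_mem) (Set.range H.basisFamily) := by
  set N := Submodule.span (ringC4C6 K n ζ H.c4_mem H.c6_mem) (Set.range H.basisFamily)
  -- The span is viewed inside plain pairs of polynomials, so that sums can be formed without
  -- membership proofs.
  let V : AddSubmonoid (Fin 2 → MvPolynomial (Fin 2) K) :=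
    { carrier := {v | ∃ y ∈ N, y.1 = v}
      zero_mem' := ⟨0, zero_mem _, rfl⟩
      add_mem' := by
        rintro _ _ ⟨y, hy, rfl⟩ ⟨z, hz, rfl⟩
        exact ⟨y + z, add_mem hy hz, rfl⟩ }
  have hsmul : ∀ P, ∀ v ∈ V, evalC K n P • v ∈ V := by
    rintro P _ ⟨y, hy, rfl⟩
    obtain ⟨c, hc⟩ := exists_coe_eq_evalC (h4 := H.c4_mem) (h6 := H.c6_mem) P
    exact ⟨c • y, Submodule.smul_mem _ c hy, by rw [← hc]; rfl⟩
  have hbasis : ∀ i, (H.basisFamily i).1 ∈ V := fun i =>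
    ⟨_, Submodule.subset_span ⟨i, rfl⟩, rfl⟩
  have h4 : del (c4 K n) ∈ V := hbasis (.inr (.inr 0))
  have h6 : del (c6 K n) ∈ V := hbasis (.inr (.inr 1))
  obtain ⟨P, Q, R, S, hPQ⟩ := H.exists_D_pow_mul_eq
  -- The power D^{n-1} is absent from the family and is supplied by ∂c₄ and ∂c₆; likewise for ∂D.
  have hUpow : ∀ i < n, D K n ^ i • U K ∈ V := fun i hi => by
    by_cases h : i < n - 1
    · exact hbasis (.inl ⟨i, h⟩)
    · have : D K n ^ i • U K = evalC K n P • del (c4 K n) + evalC K n Q • del (c6 K n) := by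
        rw [show i = n - 1 by omega]
        exact funext fun j => (hPQ j).1
      rw [this]
      exact add_mem (hsmul _ _ h4) (hsmul _ _ h6)
  have hDpow : ∀ i < n, D K n ^ i • del (D K n) ∈ V := fun i hi => by
    by_cases h : i < n - 1
    · exact hbasis (.inr (.inl ⟨i, h⟩))
    · have : D K n ^ i • del (D K n) =
          evalC K n R • del (c4 K n) + evalC K n S • del (c6 K n) := by
        rw [show i = n - 1 by omega]
        exact funext fun j => (hPQ j).2
      rw [this]
      exact add_mem (hsmul _ _ h4) (hsmul _ _ h6)
  have hcomb : ∀ v : Fin 2 → MvPolynomial (Fin 2) K, (∀ i < n, D K n ^ i • v ∈ V) →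
      ∀ f ∈ discreteInvariants K n ζ, f • v ∈ V := by
    intro v hv f hf
    obtain ⟨P, rfl⟩ := H.isCombination_of_mem hgap hf
    rw [Finset.sum_smul]
    refine sum_mem fun i hi => ?_
    rw [mul_smul]
    exact hsmul _ _ (hv i (Finset.mem_range.1 hi))
  rintro ⟨p, hp⟩ -
  obtain ⟨P, Q, f, hf, g, hg, hpj⟩ := H.exists_eq_of_mem_discreteCovariants hgap hp
  have hpV : p ∈ V := by
    have : p = evalC K n P • del (c4 K n) + evalC K n Q • del (c6 K n) + f • U K +
        g • del (D K n) := funext hpj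
    rw [this]
    exact add_mem (add_mem (add_mem (hsmul _ _ h4) (hsmul _ _ h6)) (hcomb _ hUpow f hf))
      (hcomb _ hDpow g hg)
  obtain ⟨y, hy, rfl⟩ := hpV
  exact hy

theorem exists_basis
    (hgap : ∀ f ∈ discreteInvariants K n ζ, f.IsHomogeneous m → restrict f = 0) :
    ∃ (h4 : c4 K n ∈ discreteInvariants K n ζ) (h6 : c6 K n ∈ discreteInvariants K n ζ)
      (B : Module.Basis (Fin (n - 1) ⊕ Fin (n - 1) ⊕ Fin 2)
        (ringC4C6 K n ζ h4 h6) (discreteCovariants K n ζ)),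
      (∀ i : Fin (n - 1), (B (.inl i) : Fin 2 → MvPolynomial (Fin 2) K) =
        D K n ^ (i : ℕ) • U K) ∧
      (∀ i : Fin (n - 1), (B (.inr (.inl i)) : Fin 2 → MvPolynomial (Fin 2) K) =
        D K n ^ (i : ℕ) • del (D K n)) ∧
      (B (.inr (.inr 0)) : Fin 2 → MvPolynomial (Fin 2) K) = del (c4 K n) ∧
      (B (.inr (.inr 1)) : Fin 2 → MvPolynomial (Fin 2) K) = del (c6 K n) ∧
      Module.rank (ringC4C6 K n ζ h4 h6) (discreteCovariants K n ζ) = 2 * n := by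
  refine ⟨H.c4_mem, H.c6_mem,
    Module.Basis.mk H.linearIndependent_basisFamily (H.span_basisFamily hgap), ?_, ?_, ?_, ?_, ?_⟩
  · intro i; rw [Module.Basis.mk_apply]; rfl
  · intro i; rw [Module.Basis.mk_apply]; rfl
  · rw [Module.Basis.mk_apply]; rfl
  · rw [Module.Basis.mk_apply]; rfl
  · rw [rank_eq_card_basis (Module.Basis.mk H.linearIndependent_basisFamily
      (H.span_basisFamily hgap))]
    simp only [Fintype.card_sum, Fintype.card_fin]
    have : n - 1 + (n - 1 + 2) = 2 * n := by have := H.two_le; omega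
    rw [this]
    push_cast
    rfl

end

end CovariantData

/-! ### Icosahedral identities -/

section Golden

variable {R : Type*} [CommRing R] {φ : R}

/-- Writing elements as x₀ + φ x₁ reduces φ² at each multiplication, so `ring` never has to handle
high powers of φ modulo the relation. -/
theorem golden_mul (h : φ ^ 2 = φ + 1) (x₀ x₁ y₀ y₁ : R) :
    (x₀ + φ * x₁) * (y₀ + φ * y₁) =
      (x₀ * y₀ + x₁ * y₁) + φ * (x₀ * y₁ + x₁ * y₀ + x₁ * y₁) := by
  linear_combination x₁ * y₁ * h

theorem golden_first_pow_five (h : φ ^ 2 = φ + 1) (a b : R) :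
    (φ * a + b) ^ 5 =
      (3 * a ^ 5 + 10 * a ^ 4 * b + 10 * a ^ 3 * b ^ 2 + 10 * a ^ 2 * b ^ 3 + b ^ 5) +
      φ * (5 * a ^ 5 + 15 * a ^ 4 * b + 20 * a ^ 3 * b ^ 2 + 10 * a ^ 2 * b ^ 3 +
        5 * a * b ^ 4) := by
  have h1 : (φ * a + b) ^ 5 =
      (b + φ * a) * (b + φ * a) * ((b + φ * a) * (b + φ * a)) * (b + φ * a) := by ring
  rw [h1, golden_mul h, golden_mul h, golden_mul h]
  ring

theorem golden_second_pow_five (h : φ ^ 2 = φ + 1) (a b : R) :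
    (a - φ * b) ^ 5 =
      (a ^ 5 + 10 * a ^ 3 * b ^ 2 - 10 * a ^ 2 * b ^ 3 + 10 * a * b ^ 4 - 3 * b ^ 5) +
      φ * (-5 * a ^ 4 * b + 10 * a ^ 3 * b ^ 2 - 20 * a ^ 2 * b ^ 3 + 15 * a * b ^ 4 -
        5 * b ^ 5) := by
  have h1 : (a - φ * b) ^ 5 =
      (a + φ * -b) * (a + φ * -b) * ((a + φ * -b) * (a + φ * -b)) * (a + φ * -b) := by ring
  rw [h1, golden_mul h, golden_mul h, golden_mul h]
  ring

theorem golden_first_pow_ten (h : φ ^ 2 = φ + 1) (a b : R) :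
    (φ * a + b) ^ 10 =
      (34 * a ^ 10 + 210 * a ^ 9 * b + 585 * a ^ 8 * b ^ 2 + 960 * a ^ 7 * b ^ 3 + 1050 * a ^ 6 *
        b ^ 4 + 756 * a ^ 5 * b ^ 5 + 420 * a ^ 4 * b ^ 6 + 120 * a ^ 3 * b ^ 7 + 45 * a ^ 2 * b ^
        8 + b ^ 10) +
      φ * (55 * a ^ 10 + 340 * a ^ 9 * b + 945 * a ^ 8 * b ^ 2 + 1560 * a ^ 7 * b ^ 3 + 1680 * a
        ^ 6 * b ^ 4 + 1260 * a ^ 5 * b ^ 5 + 630 * a ^ 4 * b ^ 6 + 240 * a ^ 3 * b ^ 7 + 45 * a ^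
        2 * b ^ 8 + 10 * a * b ^ 9) := by
  have h1 : (φ * a + b) ^ 10 = (φ * a + b) ^ 5 * (φ * a + b) ^ 5 := by ring
  rw [h1, golden_first_pow_five h, golden_mul h]
  ring

theorem golden_mixed_pow_five (h : φ ^ 2 = φ + 1) (a b : R) :
    (φ * a + b) ^ 5 * (a - φ * b) ^ 5 =
      (3 * a ^ 10 - 15 * a ^ 9 * b + 15 * a ^ 8 * b ^ 2 + 30 * a ^ 7 * b ^ 3 - 45 * a ^ 6 * b ^ 4
        - 33 * a ^ 5 * b ^ 5 + 45 * a ^ 4 * b ^ 6 + 30 * a ^ 3 * b ^ 7 - 15 * a ^ 2 * b ^ 8 - 15 *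
        a * b ^ 9 - 3 * b ^ 10) +
      φ * (5 * a ^ 10 - 25 * a ^ 9 * b + 25 * a ^ 8 * b ^ 2 + 50 * a ^ 7 * b ^ 3 - 75 * a ^ 6 * b
        ^ 4 - 55 * a ^ 5 * b ^ 5 + 75 * a ^ 4 * b ^ 6 + 50 * a ^ 3 * b ^ 7 - 25 * a ^ 2 * b ^ 8 -
        25 * a * b ^ 9 - 5 * b ^ 10) := by
  rw [golden_first_pow_five h, golden_second_pow_five h, golden_mul h]
  ring

theorem golden_second_pow_ten (h : φ ^ 2 = φ + 1) (a b : R) :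
    (a - φ * b) ^ 10 =
      (a ^ 10 + 45 * a ^ 8 * b ^ 2 - 120 * a ^ 7 * b ^ 3 + 420 * a ^ 6 * b ^ 4 - 756 * a ^ 5 * b
        ^ 5 + 1050 * a ^ 4 * b ^ 6 - 960 * a ^ 3 * b ^ 7 + 585 * a ^ 2 * b ^ 8 - 210 * a * b ^ 9 +
        34 * b ^ 10) +
      φ * (-10 * a ^ 9 * b + 45 * a ^ 8 * b ^ 2 - 240 * a ^ 7 * b ^ 3 + 630 * a ^ 6 * b ^ 4 -
        1260 * a ^ 5 * b ^ 5 + 1680 * a ^ 4 * b ^ 6 - 1560 * a ^ 3 * b ^ 7 + 945 * a ^ 2 * b ^ 8 -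
        340 * a * b ^ 9 + 55 * b ^ 10) := by
  have h1 : (a - φ * b) ^ 10 = (a - φ * b) ^ 5 * (a - φ * b) ^ 5 := by ring
  rw [h1, golden_second_pow_five h, golden_mul h]
  ring

/-- The factor is (φ + 2)⁶, a power of the determinant -(φ + 2) of S; for c₄ and c₆ below it is (φ +
2)¹⁰ and -(φ + 2)¹⁵. -/
theorem golden_D (h : φ ^ 2 = φ + 1) (a b : R) :
    (φ * a + b) * (a - φ * b) * ((φ * a + b) ^ 10 - 11 * (φ * a + b) ^ 5 * (a - φ * b) ^ 5 -
      (a - φ * b) ^ 10) =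
    125 * (5 + 8 * φ) * (a * b * (a ^ 10 - 11 * a ^ 5 * b ^ 5 - b ^ 10)) := by
  have h1 : (φ * a + b) * (a - φ * b) = (b + φ * a) * (a + φ * -b) := by ring
  have h2 : ∀ x₀ x₁ y₀ y₁ z₀ z₁ : R,
      (x₀ + φ * x₁) - 11 * (y₀ + φ * y₁) - (z₀ + φ * z₁) =
        (x₀ - 11 * y₀ - z₀) + φ * (x₁ - 11 * y₁ - z₁) := by intros; ring
  rw [mul_assoc 11, golden_first_pow_ten h, golden_mixed_pow_five h, golden_second_pow_ten h, h1,
    h2, golden_mul h, golden_mul h]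
  ring

theorem golden_c4 (h : φ ^ 2 = φ + 1) (a b : R) :
    (φ * a + b) ^ 20 + 228 * (φ * a + b) ^ 15 * (a - φ * b) ^ 5 +
      494 * (φ * a + b) ^ 10 * (a - φ * b) ^ 10 - 228 * (φ * a + b) ^ 5 * (a - φ * b) ^ 15 +
      (a - φ * b) ^ 20 =
    3125 * (34 + 55 * φ) * (a ^ 20 + 228 * a ^ 15 * b ^ 5 + 494 * a ^ 10 * b ^ 10 -
      228 * a ^ 5 * b ^ 15 + b ^ 20) := by
  have h1 : (φ * a + b) ^ 20 + 228 * (φ * a + b) ^ 15 * (a - φ * b) ^ 5 +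
      494 * (φ * a + b) ^ 10 * (a - φ * b) ^ 10 - 228 * (φ * a + b) ^ 5 * (a - φ * b) ^ 15 +
      (a - φ * b) ^ 20 =
      (φ * a + b) ^ 10 * (φ * a + b) ^ 10 +
        228 * ((φ * a + b) ^ 10 * ((φ * a + b) ^ 5 * (a - φ * b) ^ 5)) +
        494 * ((φ * a + b) ^ 10 * (a - φ * b) ^ 10) -
        228 * ((φ * a + b) ^ 5 * (a - φ * b) ^ 5 * (a - φ * b) ^ 10) +
        (a - φ * b) ^ 10 * (a - φ * b) ^ 10 := by
    -- With the sums hidden, `ring` only regroups monomials in two atoms.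
    generalize φ * a + b = s
    generalize a - φ * b = t
    ring
  rw [h1, golden_first_pow_ten h, golden_mixed_pow_five h, golden_second_pow_ten h]
  simp only [golden_mul h]
  ring

theorem golden_c6 (h : φ ^ 2 = φ + 1) (a b : R) :
    -(φ * a + b) ^ 30 + 522 * (φ * a + b) ^ 25 * (a - φ * b) ^ 5 +
      10005 * (φ * a + b) ^ 20 * (a - φ * b) ^ 10 + 10005 * (φ * a + b) ^ 10 * (a - φ * b) ^ 20 -
      522 * (φ * a + b) ^ 5 * (a - φ * b) ^ 25 - (a - φ * b) ^ 30 =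
    -(78125 * (843 + 1364 * φ)) * (-a ^ 30 + 522 * a ^ 25 * b ^ 5 + 10005 * a ^ 20 * b ^ 10 +
      10005 * a ^ 10 * b ^ 20 - 522 * a ^ 5 * b ^ 25 - b ^ 30) := by
  have h1 : -(φ * a + b) ^ 30 + 522 * (φ * a + b) ^ 25 * (a - φ * b) ^ 5 +
      10005 * (φ * a + b) ^ 20 * (a - φ * b) ^ 10 + 10005 * (φ * a + b) ^ 10 * (a - φ * b) ^ 20 -
      522 * (φ * a + b) ^ 5 * (a - φ * b) ^ 25 - (a - φ * b) ^ 30 =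
      (φ * a + b) ^ 10 * (φ * a + b) ^ 10 * (-(φ * a + b) ^ 10 +
        522 * ((φ * a + b) ^ 5 * (a - φ * b) ^ 5) + 10005 * (a - φ * b) ^ 10) +
      (a - φ * b) ^ 10 * (a - φ * b) ^ 10 * (10005 * (φ * a + b) ^ 10 -
        522 * ((φ * a + b) ^ 5 * (a - φ * b) ^ 5) - (a - φ * b) ^ 10) := by
    generalize φ * a + b = s
    generalize a - φ * b = t
    ring
  have h2 : ∀ x₀ x₁ y₀ y₁ z₀ z₁ : R,
      -(x₀ + φ * x₁) + 522 * (y₀ + φ * y₁) + 10005 * (z₀ + φ * z₁) =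
        (-x₀ + 522 * y₀ + 10005 * z₀) + φ * (-x₁ + 522 * y₁ + 10005 * z₁) := by intros; ring
  have h3 : ∀ x₀ x₁ y₀ y₁ z₀ z₁ : R,
      10005 * (x₀ + φ * x₁) - 522 * (y₀ + φ * y₁) - (z₀ + φ * z₁) =
        (10005 * x₀ - 522 * y₀ - z₀) + φ * (10005 * x₁ - 522 * y₁ - z₁) := by intros; ring
  rw [h1, golden_first_pow_ten h, golden_mixed_pow_five h, golden_second_pow_ten h, h2, h3]
  simp only [golden_mul h]
  ring

end Golden

/-! ### Preparations for the individual groups -/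

section Tools

theorem map_D {R S : Type*} [CommRing R] [CommRing S] (g : R →+* S) (n : ℕ) :
    map g (D R n) = D S n := by
  unfold D
  split <;> simp

theorem map_c4 {R S : Type*} [CommRing R] [CommRing S] (g : R →+* S) (n : ℕ) :
    map g (c4 R n) = c4 S n := by
  unfold c4
  split <;> simp

theorem map_c6 {R S : Type*} [CommRing R] [CommRing S] (g : R →+* S) (n : ℕ) :
    map g (c6 R n) = c6 S n := by
  unfold c6
  split <;> simp

theorem isHomogeneous_term {R : Type*} [CommRing R] (c : R) {i j d : ℕ} (h : i + j = d) :
    (C c * X 0 ^ i * X 1 ^ j : MvPolynomial (Fin 2) R).IsHomogeneous d :=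
  h ▸ (isHomogeneous_C_mul_X_pow c 0 i).mul (isHomogeneous_X_pow 1 j)

variable {K : Type*} [Field K] {n : ℕ} {ζ : AlgebraicClosure K}

local notation "φK" => algebraMap K (AlgebraicClosure K)

theorem mem_discreteInvariants_of_semiinvariant {f : MvPolynomial (Fin 2) K}
    {g : MvPolynomial (Fin 2) (AlgebraicClosure K)} (hfg : map φK f = g) {k : ℕ}
    (hf : f.IsHomogeneous k) {c d : AlgebraicClosure K} (hc : c ≠ 0) (hd : d ≠ 0)
    (hS : ∀ v, eval ((genS n ζ).mulVec v) g = c * eval v g)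
    (hT : ∀ v, eval ((genT ζ).mulVec v) g = d * eval v g) :
    f ∈ discreteInvariants K n ζ := by
  subst hfg
  intro γ hγ v
  have := eval_mulVec_eq_of_mem_Gamma (hf.map φK) hc hd hS hT hγ v
  rwa [eval_map, eval_map] at this

theorem genT_mulVec (v : Fin 2 → AlgebraicClosure K) :
    (genT ζ).mulVec v = ![v 0, ζ * v 1] := by
  ext i
  fin_cases i <;> simp [genT, Matrix.mulVec, dotProduct, Fin.sum_univ_two]

theorem det_genT_ne_zero (hζ : ζ ≠ 0) : (genT ζ).det ≠ 0 := by
  simpa [genT, Matrix.det_fin_two] using hζ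

/-- Conjugation by T^j multiplies the off-diagonal entries by ζ^j and ζ^{-j}. -/
theorem IsGammaMatrix.conj_pow (hζ : ζ ≠ 0) {p q r s q' r' : AlgebraicClosure K}
    (hM : IsGammaMatrix n ζ !![p, q; r, s]) (j : ℕ) (hq : q' = q * ζ ^ j) (hr : r' * ζ ^ j = r) :
    IsGammaMatrix n ζ !![p, q'; r', s] := by
  induction j generalizing q' r' with
  | zero =>
    rw [pow_zero, mul_one] at hq hr
    rwa [hq, hr]
  | succ j ih =>
    refine (ih (q' := q * ζ ^ j) (r' := r' * ζ) rfl
      (by rw [← hr]; ring)).conj (det_genT_ne_zero hζ) ?_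
    rw [hq]
    ext a b
    fin_cases a <;> fin_cases b <;> simp [genT, Matrix.mul_apply, Fin.sum_univ_two] <;> ring

/-- If a divides f, then a ∘ M, the first row of M as a linear form, divides f ∘ M = f. -/
theorem linearForm_dvd {f : MvPolynomial (Fin 2) K} (hf : f ∈ discreteInvariants K n ζ)
    (h0 : restrict f = 0) {M : Matrix (Fin 2) (Fin 2) (AlgebraicClosure K)}
    (hM : IsGammaMatrix n ζ M) : C (M 0 0) * X 0 + C (M 0 1) * X 1 ∣ map φK f := by
  have h1 := (X_zero_dvd_of_restrict_eq_zero h0)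
  have h2 := _root_.map_dvd (map φK) h1
  have h3 := _root_.map_dvd (subst M) h2
  rwa [map_X, subst_X, subst_map_of_mem hf hM] at h3

theorem X_zero_dvd {f : MvPolynomial (Fin 2) K} (h0 : restrict f = 0) : X 0 ∣ map φK f := by
  have := _root_.map_dvd (map φK) (X_zero_dvd_of_restrict_eq_zero h0)
  rwa [map_X] at this

theorem X_one_dvd {f : MvPolynomial (Fin 2) K} (hf : f ∈ discreteInvariants K n ζ)
    (h0 : restrict f = 0) {q r s : AlgebraicClosure K}
    (hM : IsGammaMatrix n ζ !![0, q; r, s]) : X 1 ∣ map φK f := by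
  have hq : q ≠ 0 := by
    rintro rfl
    have := hM.det_eq_one
    simp [Matrix.det_fin_two] at this
  have h := linearForm_dvd hf h0 hM
  have hu : IsUnit (C q : MvPolynomial (Fin 2) (AlgebraicClosure K)) :=
    (isUnit_iff_ne_zero.2 hq).map C
  have e : (C ((!![0, q; r, s] : Matrix (Fin 2) (Fin 2) (AlgebraicClosure K)) 0 0) * X 0 +
      C ((!![0, q; r, s] : Matrix (Fin 2) (Fin 2) (AlgebraicClosure K)) 0 1) * X 1 :
      MvPolynomial (Fin 2) (AlgebraicClosure K)) = C q * X 1 := by simp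
  rw [e] at h
  exact hu.mul_left_dvd.1 h

/-- The conjugates by powers of T give the factors p(a + l ζ^j b), whose product over j < n is pⁿ(aⁿ
- (-l)ⁿ bⁿ). -/
theorem binomial_dvd (hn : 0 < n) (hζ : IsPrimitiveRoot ζ n) {f : MvPolynomial (Fin 2) K}
    (hf : f ∈ discreteInvariants K n ζ) (h0 : restrict f = 0) {p l r s κ : AlgebraicClosure K}
    (hM : IsGammaMatrix n ζ !![p, p * l; r, s]) (hκ : (-l) ^ n = κ) (hκ0 : κ ≠ 0) :
    X 0 ^ n - C κ * X 1 ^ n ∣ map φK f := by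
  have hp : p ≠ 0 := by
    rintro rfl
    have := hM.det_eq_one
    simp [Matrix.det_fin_two] at this
  have hl : l ≠ 0 := by
    rintro rfl
    rw [neg_zero, zero_pow hn.ne'] at hκ
    exact hκ0 hκ.symm
  have hζ0 : ζ ≠ 0 := hζ.ne_zero hn.ne'
  have hu : IsUnit (C (p ^ n) : MvPolynomial (Fin 2) (AlgebraicClosure K)) :=
    (isUnit_iff_ne_zero.2 (pow_ne_zero _ hp)).map C
  rw [← hu.mul_left_dvd]
  have h := sub_pow_dvd_of_forall_dvd hn hζ hp (mul_ne_zero hp hl) (g := map φK f) fun j => by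
    have := linearForm_dvd hf h0 (hM.conj_pow hζ0 j (r' := r * (ζ ^ j)⁻¹) rfl
      (inv_mul_cancel_right₀ (pow_ne_zero _ hζ0) r))
    simpa using this
  convert! h using 1
  rw [mul_sub, ← mul_assoc, ← C_mul, ← hκ, ← mul_pow, mul_neg]

theorem isGammaMatrix_commutator {p q r s : AlgebraicClosure K} (hζ : ζ ≠ 0)
    (hS : (genS n ζ).det ≠ 0) (hdet : p * s - q * r = 1)
    (h : !![p, q; r, s] * (genT ζ * genS n ζ) = genS n ζ * genT ζ) :
    IsGammaMatrix n ζ !![p, q; r, s] :=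
  isGammaMatrix_of_mul_eq hS (det_genT_ne_zero hζ) _ (by rw [Matrix.det_fin_two_of, hdet]) h

theorem isRelPrime_X_zero_pow_sub {F : Type*} [Field F] {n : ℕ} (hn : 0 < n) {κ : F}
    (hκ : κ ≠ 0) : IsRelPrime (X 0 : MvPolynomial (Fin 2) F) (X 0 ^ n - C κ * X 1 ^ n) := by
  simpa using isRelPrime_X_zero_binomial hn (A := 1) hκ

theorem isRelPrime_X_one_pow_sub {F : Type*} [Field F] {n : ℕ} (hn : 0 < n) (κ : F) :
    IsRelPrime (X 1 : MvPolynomial (Fin 2) F) (X 0 ^ n - C κ * X 1 ^ n) := by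
  simpa using isRelPrime_X_one_binomial hn (A := 1) (B := κ) one_ne_zero

theorem isRelPrime_pow_sub_pow_sub {F : Type*} [Field F] {n : ℕ} {κ κ' : F} (h : κ' - κ ≠ 0) :
    IsRelPrime (X 0 ^ n - C κ * X 1 ^ n : MvPolynomial (Fin 2) F) (X 0 ^ n - C κ' * X 1 ^ n) := by
  simpa using isRelPrime_binomial_binomial (n := n) (A := 1) (B := κ) (A' := 1) (B' := κ')
    (by simpa using h)

theorem D_dvd_of_map_eq {f : MvPolynomial (Fin 2) K}
    {g : MvPolynomial (Fin 2) (AlgebraicClosure K)} {k : AlgebraicClosure K} (hk : k ≠ 0)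
    (hD : D (AlgebraicClosure K) n = C k * g) (hg : g ∣ map φK f) : D K n ∣ f := by
  apply dvd_of_map_dvd_map (F := AlgebraicClosure K)
  have hu : IsUnit (C k : MvPolynomial (Fin 2) (AlgebraicClosure K)) :=
    (isUnit_iff_ne_zero.2 hk).map C
  rw [map_D, hD, hu.mul_left_dvd]
  exact hg

end Tools

/-! ### Elementary properties of the forms -/

section Forms

variable (R : Type*) [CommRing R]

theorem isHomogeneous_int_term {R : Type*} [CommRing R] (c : ℤ) {i j d : ℕ} (h : i + j = d) :
    ((c : MvPolynomial (Fin 2) R) * X 0 ^ i * X 1 ^ j).IsHomogeneous d := by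
  rw [← map_intCast (C (σ := Fin 2) (R := R)) c]
  exact isHomogeneous_term _ h

theorem D_isHomogeneous_two : (D R 2).IsHomogeneous 3 := by
  have : D R 2 = ((64 : ℤ) : MvPolynomial (Fin 2) R) * X 0 ^ 3 * X 1 ^ 0 +
      ((-1 : ℤ) : MvPolynomial (Fin 2) R) * X 0 ^ 1 * X 1 ^ 2 := by
    simp only [D]; push_cast; ring
  rw [this]
  exact (isHomogeneous_int_term _ (by norm_num)).add (isHomogeneous_int_term _ (by norm_num))

theorem c4_isHomogeneous_two : (c4 R 2).IsHomogeneous 2 := by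
  have : c4 R 2 = ((192 : ℤ) : MvPolynomial (Fin 2) R) * X 0 ^ 2 * X 1 ^ 0 +
      ((1 : ℤ) : MvPolynomial (Fin 2) R) * X 0 ^ 0 * X 1 ^ 2 := by
    simp only [c4]; push_cast; ring
  rw [this]
  exact (isHomogeneous_int_term _ (by norm_num)).add (isHomogeneous_int_term _ (by norm_num))

theorem c6_isHomogeneous_two : (c6 R 2).IsHomogeneous 3 := by
  have : c6 R 2 = ((576 : ℤ) : MvPolynomial (Fin 2) R) * X 0 ^ 2 * X 1 ^ 1 +
      ((-1 : ℤ) : MvPolynomial (Fin 2) R) * X 0 ^ 0 * X 1 ^ 3 := by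
    simp only [c6]; push_cast; ring
  rw [this]
  exact (isHomogeneous_int_term _ (by norm_num)).add (isHomogeneous_int_term _ (by norm_num))

theorem D_isHomogeneous_three : (D R 3).IsHomogeneous 4 := by
  have : D R 3 = ((-27 : ℤ) : MvPolynomial (Fin 2) R) * X 0 ^ 4 * X 1 ^ 0 +
      ((-1 : ℤ) : MvPolynomial (Fin 2) R) * X 0 ^ 1 * X 1 ^ 3 := by
    simp only [D]; push_cast; ring
  rw [this]
  exact (isHomogeneous_int_term _ (by norm_num)).add (isHomogeneous_int_term _ (by norm_num))

theorem c4_isHomogeneous_three : (c4 R 3).IsHomogeneous 4 := by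
  have : c4 R 3 = ((-216 : ℤ) : MvPolynomial (Fin 2) R) * X 0 ^ 3 * X 1 ^ 1 +
      ((1 : ℤ) : MvPolynomial (Fin 2) R) * X 0 ^ 0 * X 1 ^ 4 := by
    simp only [c4]; push_cast; ring
  rw [this]
  exact (isHomogeneous_int_term _ (by norm_num)).add (isHomogeneous_int_term _ (by norm_num))

theorem c6_isHomogeneous_three : (c6 R 3).IsHomogeneous 6 := by
  have : c6 R 3 = ((5832 : ℤ) : MvPolynomial (Fin 2) R) * X 0 ^ 6 * X 1 ^ 0 +
      ((-540 : ℤ) : MvPolynomial (Fin 2) R) * X 0 ^ 3 * X 1 ^ 3 +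
      ((-1 : ℤ) : MvPolynomial (Fin 2) R) * X 0 ^ 0 * X 1 ^ 6 := by
    simp only [c6]; push_cast; ring
  rw [this]
  exact ((isHomogeneous_int_term _ (by norm_num)).add (isHomogeneous_int_term _ (by norm_num))).add
    (isHomogeneous_int_term _ (by norm_num))

theorem D_isHomogeneous_four : (D R 4).IsHomogeneous 6 := by
  have : D R 4 = ((16 : ℤ) : MvPolynomial (Fin 2) R) * X 0 ^ 5 * X 1 ^ 1 +
      ((-1 : ℤ) : MvPolynomial (Fin 2) R) * X 0 ^ 1 * X 1 ^ 5 := by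
    simp only [D]; push_cast; ring
  rw [this]
  exact (isHomogeneous_int_term _ (by norm_num)).add (isHomogeneous_int_term _ (by norm_num))

theorem c4_isHomogeneous_four : (c4 R 4).IsHomogeneous 8 := by
  have : c4 R 4 = ((256 : ℤ) : MvPolynomial (Fin 2) R) * X 0 ^ 8 * X 1 ^ 0 +
      ((224 : ℤ) : MvPolynomial (Fin 2) R) * X 0 ^ 4 * X 1 ^ 4 +
      ((1 : ℤ) : MvPolynomial (Fin 2) R) * X 0 ^ 0 * X 1 ^ 8 := by
    simp only [c4]; push_cast; ring
  rw [this]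
  exact ((isHomogeneous_int_term _ (by norm_num)).add (isHomogeneous_int_term _ (by norm_num))).add
    (isHomogeneous_int_term _ (by norm_num))

theorem c6_isHomogeneous_four : (c6 R 4).IsHomogeneous 12 := by
  have : c6 R 4 = ((-4096 : ℤ) : MvPolynomial (Fin 2) R) * X 0 ^ 12 * X 1 ^ 0 +
      ((8448 : ℤ) : MvPolynomial (Fin 2) R) * X 0 ^ 8 * X 1 ^ 4 +
      ((528 : ℤ) : MvPolynomial (Fin 2) R) * X 0 ^ 4 * X 1 ^ 8 +
      ((-1 : ℤ) : MvPolynomial (Fin 2) R) * X 0 ^ 0 * X 1 ^ 12 := by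
    simp only [c6]; push_cast; ring
  rw [this]
  exact (((isHomogeneous_int_term _ (by norm_num)).add (isHomogeneous_int_term _ (by norm_num))).add
    (isHomogeneous_int_term _ (by norm_num))).add (isHomogeneous_int_term _ (by norm_num))

theorem D_isHomogeneous_five : (D R 5).IsHomogeneous 12 := by
  have : D R 5 = ((1 : ℤ) : MvPolynomial (Fin 2) R) * X 0 ^ 11 * X 1 ^ 1 +
      ((-11 : ℤ) : MvPolynomial (Fin 2) R) * X 0 ^ 6 * X 1 ^ 6 +
      ((-1 : ℤ) : MvPolynomial (Fin 2) R) * X 0 ^ 1 * X 1 ^ 11 := by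
    simp only [D]; push_cast; ring
  rw [this]
  exact ((isHomogeneous_int_term _ (by norm_num)).add (isHomogeneous_int_term _ (by norm_num))).add
    (isHomogeneous_int_term _ (by norm_num))

theorem c4_isHomogeneous_five : (c4 R 5).IsHomogeneous 20 := by
  have : c4 R 5 = ((1 : ℤ) : MvPolynomial (Fin 2) R) * X 0 ^ 20 * X 1 ^ 0 +
      ((228 : ℤ) : MvPolynomial (Fin 2) R) * X 0 ^ 15 * X 1 ^ 5 +
      ((494 : ℤ) : MvPolynomial (Fin 2) R) * X 0 ^ 10 * X 1 ^ 10 +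
      ((-228 : ℤ) : MvPolynomial (Fin 2) R) * X 0 ^ 5 * X 1 ^ 15 +
      ((1 : ℤ) : MvPolynomial (Fin 2) R) * X 0 ^ 0 * X 1 ^ 20 := by
    simp only [c4]; push_cast; ring
  rw [this]
  exact ((((isHomogeneous_int_term _ (by norm_num)).add
    (isHomogeneous_int_term _ (by norm_num))).add
    (isHomogeneous_int_term _ (by norm_num))).add (isHomogeneous_int_term _ (by norm_num))).add
    (isHomogeneous_int_term _ (by norm_num))

theorem c6_isHomogeneous_five : (c6 R 5).IsHomogeneous 30 := by
  have : c6 R 5 = ((-1 : ℤ) : MvPolynomial (Fin 2) R) * X 0 ^ 30 * X 1 ^ 0 +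
      ((522 : ℤ) : MvPolynomial (Fin 2) R) * X 0 ^ 25 * X 1 ^ 5 +
      ((10005 : ℤ) : MvPolynomial (Fin 2) R) * X 0 ^ 20 * X 1 ^ 10 +
      ((10005 : ℤ) : MvPolynomial (Fin 2) R) * X 0 ^ 10 * X 1 ^ 20 +
      ((-522 : ℤ) : MvPolynomial (Fin 2) R) * X 0 ^ 5 * X 1 ^ 25 +
      ((-1 : ℤ) : MvPolynomial (Fin 2) R) * X 0 ^ 0 * X 1 ^ 30 := by
    simp only [c6]; push_cast; ring
  rw [this]
  exact (((((isHomogeneous_int_term _ (by norm_num)).add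
    (isHomogeneous_int_term _ (by norm_num))).add
    (isHomogeneous_int_term _ (by norm_num))).add (isHomogeneous_int_term _ (by norm_num))).add
    (isHomogeneous_int_term _ (by norm_num))).add (isHomogeneous_int_term _ (by norm_num))

theorem c4_pow_sub_c6_pow (n : ℕ) (h2 : 2 ≤ n) (h5 : n ≤ 5) :
    c4 R n ^ 3 - c6 R n ^ 2 = 1728 * D R n ^ n := by
  interval_cases n <;>
  · simp only [c4, c6, D]
    ring

/-- `∂(D, c₆)/∂(a, b) = (deg c₆) c₄²`. -/
theorem jacobian_D_c6 (n : ℕ) (h2 : 2 ≤ n) (h5 : n ≤ 5) :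
    pderiv 0 (D R n) * pderiv 1 (c6 R n) - pderiv 1 (D R n) * pderiv 0 (c6 R n) =
      ((6 * n / (6 - n) : ℕ) : MvPolynomial (Fin 2) R) * c4 R n ^ 2 := by
  have ofN : ∀ (i : Fin 2) (m : ℕ) [m.AtLeastTwo],
      pderiv i (OfNat.ofNat m : MvPolynomial (Fin 2) R) = 0 := fun i m _ => by
    rw [← Nat.cast_ofNat (R := MvPolynomial (Fin 2) R)]
    exact Derivation.map_natCast _ _
  interval_cases n <;>
  · simp [D, c6, c4, ofN, pderiv_X]
    ring

theorem jacobian_D_c4 (n : ℕ) (h2 : 2 ≤ n) (h5 : n ≤ 5) :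
    pderiv 0 (D R n) * pderiv 1 (c4 R n) - pderiv 1 (D R n) * pderiv 0 (c4 R n) =
      ((4 * n / (6 - n) : ℕ) : MvPolynomial (Fin 2) R) * c6 R n := by
  rw [c6_spec R n h2 h5, Matrix.det_fin_two_of]

theorem restrict_D (n : ℕ) : restrict (D R n) = 0 := by
  unfold D
  split <;> simp

theorem restrict_c4 (n : ℕ) (h2 : 2 ≤ n) (h5 : n ≤ 5) :
    restrict (c4 R n) = Polynomial.X ^ (4 * n / (6 - n)) := by
  interval_cases n <;> simp [c4]

theorem restrict_c6 (n : ℕ) (h2 : 2 ≤ n) (h5 : n ≤ 5) :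
    restrict (c6 R n) = -Polynomial.X ^ (6 * n / (6 - n)) := by
  interval_cases n <;> simp [c6]

theorem restrict_pderiv_D (n : ℕ) (h2 : 2 ≤ n) (h5 : n ≤ 5) :
    restrict (pderiv 0 (D R n)) = -Polynomial.X ^ (2 * n / (6 - n) + 1) := by
  have ofN : ∀ (i : Fin 2) (m : ℕ) [m.AtLeastTwo],
      pderiv i (OfNat.ofNat m : MvPolynomial (Fin 2) R) = 0 := fun i m _ => by
    rw [← Nat.cast_ofNat (R := MvPolynomial (Fin 2) R)]
    exact Derivation.map_natCast _ _
  interval_cases n <;> simp [D, ofN, pderiv_X] <;> ring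

end Forms

/-! ### The data for `n = 2, 3, 4` -/

section Small

theorem matrix_fin_two_congr {F : Type*} {a b c d a' b' c' d' : F} (ha : a = a') (hb : b = b')
    (hc : c = c') (hd : d = d') : !![a, b; c, d] = !![a', b'; c', d'] := by
  rw [ha, hb, hc, hd]

variable {K : Type*} [Field K] {n : ℕ} {ζ : AlgebraicClosure K}

local notation "φK" => algebraMap K (AlgebraicClosure K)

theorem IsGammaMatrix.mul_fin_two {p q r s p' q' r' s' a b c d : AlgebraicClosure K}
    (hM : IsGammaMatrix n ζ !![p, q; r, s]) (hN : IsGammaMatrix n ζ !![p', q'; r', s'])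
    (ha : p * p' + q * r' = a) (hb : p * q' + q * s' = b) (hc : r * p' + s * r' = c)
    (hd : r * q' + s * s' = d) : IsGammaMatrix n ζ !![a, b; c, d] := by
  have := hM.mul hN
  rwa [Matrix.mul_fin_two, ha, hb, hc, hd] at this

theorem ofNat_ne_zero_algebraicClosure {k : ℕ} [k.AtLeastTwo] (h : (OfNat.ofNat k : K) ≠ 0) :
    (OfNat.ofNat k : AlgebraicClosure K) ≠ 0 := by
  have := (map_ne_zero φK).2 h
  rwa [map_ofNat] at this

/-! ### The case n = 2. -/

section Two

theorem genS_two_mulVec (v : Fin 2 → AlgebraicClosure K) :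
    (genS 2 ζ).mulVec v = ![v 0 + v 1 / 8, 24 * v 0 - v 1] := by
  ext i
  fin_cases i <;> simp [genS, Matrix.mulVec, dotProduct, Fin.sum_univ_two] <;> ring

/-- The commutator of S and T; its first row and the conjugate by T give the factors a ± b/8 of D.
-/
theorem isGammaMatrix_two (h2 : (2 : AlgebraicClosure K) ≠ 0) (hζ : ζ = -1) :
    IsGammaMatrix 2 ζ !![-1 / 2, -1 / 2 * (1 / 8); 12, -1 / 2] := by
  subst hζ
  have h8 : (8 : AlgebraicClosure K) ≠ 0 := by
    rw [show (8 : AlgebraicClosure K) = 2 ^ 3 by norm_num]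
    exact pow_ne_zero _ h2
  refine isGammaMatrix_commutator (neg_ne_zero.2 one_ne_zero) ?_ (by grind) ?_
  · simp only [genS, Matrix.det_fin_two_of]
    grind
  · simp only [genS, genT, Matrix.mul_fin_two]
    apply matrix_fin_two_congr <;> grind

theorem covariantData_two (h2 : (2 : K) ≠ 0) (h3 : (3 : K) ≠ 0) (hζ : IsPrimitiveRoot ζ 2) :
    CovariantData K 2 ζ 1 := by
  have hζ' : ζ = -1 := hζ.eq_neg_one_of_two_right
  have h2' : (2 : AlgebraicClosure K) ≠ 0 := ofNat_ne_zero_algebraicClosure h2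
  have h4' : (4 : AlgebraicClosure K) ≠ 0 := by
    rw [show (4 : AlgebraicClosure K) = 2 ^ 2 by norm_num]
    exact pow_ne_zero _ h2'
  have h8' : (8 : AlgebraicClosure K) ≠ 0 := by
    rw [show (8 : AlgebraicClosure K) = 2 ^ 3 by norm_num]
    exact pow_ne_zero _ h2'
  have h64' : (64 : AlgebraicClosure K) ≠ 0 := by
    rw [show (64 : AlgebraicClosure K) = 2 ^ 6 by norm_num]
    exact pow_ne_zero _ h2'
  exact
  { two_le := le_rfl
    m_pos := one_pos
    two_ne := h2
    three_ne := h3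
    m_ne := by simp
    m_add_two_ne := by convert! h3 using 1; norm_num
    D_mem := by
      refine mem_discreteInvariants_of_semiinvariant (map_D _ 2) (D_isHomogeneous_two K)
        (c := -8) (d := 1) (neg_ne_zero.2 h8') one_ne_zero (fun v => ?_) fun v => ?_
      · rw [genS_two_mulVec]
        simp only [D, map_mul, map_sub, map_pow, eval_X, map_ofNat, Matrix.cons_val_zero,
          Matrix.cons_val_one]
        field_simp
        ring
      · rw [genT_mulVec, hζ']
        simp [D]
    c4_mem := by
      refine mem_discreteInvariants_of_semiinvariant (map_c4 _ 2) (c4_isHomogeneous_two K)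
        (c := 4) (d := 1) h4' one_ne_zero (fun v => ?_) fun v => ?_
      · rw [genS_two_mulVec]
        simp only [c4, map_mul, map_add, map_pow, eval_X, map_ofNat, Matrix.cons_val_zero,
          Matrix.cons_val_one]
        field_simp
        ring
      · rw [genT_mulVec, hζ']
        simp [c4]
    c6_mem := by
      refine mem_discreteInvariants_of_semiinvariant (map_c6 _ 2) (c6_isHomogeneous_two K)
        (c := 8) (d := -1) h8' (neg_ne_zero.2 one_ne_zero) (fun v => ?_) fun v => ?_
      · rw [genS_two_mulVec]
        simp only [c6, map_mul, map_sub, map_pow, eval_X, map_ofNat, Matrix.cons_val_zero,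
          Matrix.cons_val_one]
        field_simp
        ring
      · rw [genT_mulVec, hζ']
        simp [c6]
        ring
    D_hom := D_isHomogeneous_two K
    c4_hom := c4_isHomogeneous_two K
    c6_hom := c6_isHomogeneous_two K
    restrict_D := restrict_D K 2
    restrict_c4 := restrict_c4 K 2 le_rfl (by norm_num)
    restrict_c6 := restrict_c6 K 2 le_rfl (by norm_num)
    restrict_pderiv := restrict_pderiv_D K 2 le_rfl (by norm_num)
    relation := c4_pow_sub_c6_pow K 2 le_rfl (by norm_num)
    jacobian_c4 := jacobian_D_c4 K 2 le_rfl (by norm_num)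
    jacobian_c6 := jacobian_D_c6 K 2 le_rfl (by norm_num)
    D_dvd := fun f hf h0 => by
      have hκ : (1 / 64 : AlgebraicClosure K) ≠ 0 := one_div_ne_zero h64'
      refine D_dvd_of_map_eq h64' (g := X 0 * (X 0 ^ 2 - C (1 / 64) * X 1 ^ 2)) ?_
        (IsRelPrime.mul_dvd (isRelPrime_X_zero_pow_sub two_pos hκ) (X_zero_dvd h0)
          (binomial_dvd two_pos hζ hf h0 (isGammaMatrix_two h2' hζ') (by norm_num) hκ))
      have e : (C 64 * C (1 / 64) : MvPolynomial (Fin 2) (AlgebraicClosure K)) = 1 := by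
        rw [← C_mul, mul_one_div_cancel h64', C_1]
      have e' : (64 : MvPolynomial (Fin 2) (AlgebraicClosure K)) = C 64 := (map_ofNat C 64).symm
      simp only [D]
      rw [e']
      linear_combination X 0 * X 1 ^ 2 * e
    coeff_eq_zero := fun f _ k hk => absurd (one_dvd k) hk }

end Two

/-! ### The case n = 3. -/

section Three

theorem genS_three_mulVec (v : Fin 2 → AlgebraicClosure K) :
    (genS 3 ζ).mulVec v = ![v 0 + v 1 / 3, 6 * v 0 - v 1] := by
  ext i
  fin_cases i <;> simp [genS, Matrix.mulVec, dotProduct, Fin.sum_univ_two] <;> ring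

theorem isGammaMatrix_three (h3 : (3 : AlgebraicClosure K) ≠ 0) (hζ : ζ ^ 2 + ζ + 1 = 0) :
    IsGammaMatrix 3 ζ !![(1 + 2 * ζ) / 3, (1 + 2 * ζ) / 3 * (ζ / 3); 2 * (1 - ζ),
      (2 * ζ ^ 2 + 1) / 3] := by
  refine isGammaMatrix_commutator (by rintro rfl; simp at hζ) ?_ (by grind) ?_
  · simp only [genS, Matrix.det_fin_two_of]
    grind
  · simp only [genS, genT, Matrix.mul_fin_two]
    apply matrix_fin_two_congr <;> grind

/-- It is the square of the commutator. -/
theorem isGammaMatrix_three_neg_one (h3 : (3 : AlgebraicClosure K) ≠ 0)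
    (hζ : ζ ^ 2 + ζ + 1 = 0) : IsGammaMatrix 3 ζ !![-1, 0; 0, -1] := by
  refine (isGammaMatrix_three h3 hζ).mul_fin_two (isGammaMatrix_three h3 hζ) ?_ ?_ ?_ ?_ <;> grind

/-- Summing over the rotations a ↦ ζ^j a kills ab and a², because 1 + ζ + ζ² = 0, and leaves only
the b² term. -/
theorem eval_sum_three_rotations (hζ : ζ ^ 2 + ζ + 1 = 0)
    {f : MvPolynomial (Fin 2) (AlgebraicClosure K)} (hf : f.IsHomogeneous 2)
    (x y : AlgebraicClosure K) :
    eval ![x, y] f + eval ![x * ζ, y] f + eval ![x * ζ ^ 2, y] f = 3 * eval ![0, y] f := by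
  simp only [eval_eq', Finset.mul_sum, ← Finset.sum_add_distrib]
  refine Finset.sum_congr rfl fun d hd => ?_
  have h := hf (mem_support_iff.1 hd)
  rw [Finsupp.weight_apply, Finsupp.sum_fintype _ _ (by simp)] at h
  simp only [Fin.sum_univ_two, Pi.one_apply, smul_eq_mul, mul_one] at h
  simp only [Fin.prod_univ_two, Matrix.cons_val_zero, Matrix.cons_val_one]
  have h0 : d 0 ≤ 2 := by omega
  generalize coeff d f = c
  generalize d 1 = j
  interval_cases d 0
  · ring
  · linear_combination c * x * y ^ j * hζ
  · linear_combination c * x ^ 2 * y ^ j * (ζ ^ 2 - ζ + 1) * hζ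

/-- For m = 2 the general argument breaks down, since m - 2 = 0 is a multiple of m. Instead, the
commutator and its conjugates by T send (0, 1) to three points that differ by rotations, where f
takes the same value. -/
theorem restrict_eq_zero_of_isHomogeneous_two (h2 : (2 : AlgebraicClosure K) ≠ 0)
    (h3 : (3 : AlgebraicClosure K) ≠ 0)
    (hζ : ζ ^ 2 + ζ + 1 = 0) {f : MvPolynomial (Fin 2) K} (hf : f ∈ discreteInvariants K 3 ζ)
    (hf2 : f.IsHomogeneous 2) : restrict f = 0 := by
  have hζ0 : ζ ≠ 0 := by rintro rfl; simp at hζ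
  have key : ∀ j : ℕ, eval ![(1 + 2 * ζ) / 3 * (ζ / 3) * ζ ^ j, (2 * ζ ^ 2 + 1) / 3]
      (map φK f) = eval ![0, 1] (map φK f) := fun j => by
    obtain ⟨γ, hγ, hM⟩ := (isGammaMatrix_three h3 hζ).conj_pow hζ0 j
      (r' := 2 * (1 - ζ) * (ζ ^ j)⁻¹) rfl (inv_mul_cancel_right₀ (pow_ne_zero _ hζ0) _)
    have h := hf γ hγ ![0, 1]
    have e : γ.1.mulVec ![0, 1] =
        ![(1 + 2 * ζ) / 3 * (ζ / 3) * ζ ^ j, (2 * ζ ^ 2 + 1) / 3] := by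
      rw [hM]
      ext i
      fin_cases i <;> simp [Matrix.mulVec, dotProduct, Fin.sum_univ_two]
    rw [e] at h
    rwa [eval_map, eval_map]
  obtain ⟨c, hc⟩ : ∃ c, restrict f = Polynomial.C c * Polynomial.X ^ 2 :=
    ⟨_, restrict_of_isHomogeneous hf2⟩
  have hval : ∀ y, eval ![0, y] (map φK f) = φK c * y ^ 2 := fun y => by
    rw [eval_map]
    have := aeval_eq_aeval_restrict f y
    rw [hc] at this
    simpa [aeval_def] using this
  have h := eval_sum_three_rotations hζ (hf2.map φK) ((1 + 2 * ζ) / 3 * (ζ / 3))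
    ((2 * ζ ^ 2 + 1) / 3)
  have k0 := key 0
  rw [pow_zero, mul_one] at k0
  have k1 := key 1
  rw [pow_one] at k1
  rw [k0, k1, key 2, hval, hval] at h
  have hc0 : φK c = 0 := by
    generalize φK c = t at h
    -- The common second coordinate has square -1/3, so the sum over rotations reads 3t = -t.
    have h4 : (2 : AlgebraicClosure K) ^ 2 * t = 0 := by grind
    exact (mul_eq_zero.1 h4).resolve_left (pow_ne_zero _ h2)
  rw [hc, (map_eq_zero φK).1 hc0, map_zero, zero_mul]

theorem covariantData_three (h2 : (2 : K) ≠ 0) (h3 : (3 : K) ≠ 0) (hζ : IsPrimitiveRoot ζ 3) :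
    CovariantData K 3 ζ 2 := by
  have hζ' : ζ ^ 2 + ζ + 1 = 0 := by
    have := hζ.geom_sum_eq_zero (by norm_num)
    simp only [Finset.sum_range_succ, Finset.sum_range_zero, pow_zero, pow_one] at this
    linear_combination this
  have hζ3 : ζ ^ 3 = 1 := hζ.pow_eq_one
  have hζ0 : ζ ≠ 0 := hζ.ne_zero (by norm_num)
  have h3' : (3 : AlgebraicClosure K) ≠ 0 := ofNat_ne_zero_algebraicClosure h3
  have h9' : (9 : AlgebraicClosure K) ≠ 0 := by
    rw [show (9 : AlgebraicClosure K) = 3 ^ 2 by norm_num]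
    exact pow_ne_zero _ h3'
  have h27' : (27 : AlgebraicClosure K) ≠ 0 := by
    rw [show (27 : AlgebraicClosure K) = 3 ^ 3 by norm_num]
    exact pow_ne_zero _ h3'
  exact
  { two_le := by norm_num
    m_pos := two_pos
    two_ne := h2
    three_ne := h3
    m_ne := by simpa using h2
    m_add_two_ne := by convert! pow_ne_zero 2 h2 using 1; norm_num
    D_mem := by
      refine mem_discreteInvariants_of_semiinvariant (map_D _ 3) (D_isHomogeneous_three K)
        (c := 9) (d := 1) h9' one_ne_zero (fun v => ?_) fun v => ?_
      · rw [genS_three_mulVec]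
        simp only [D, map_mul, map_add, map_neg, map_pow, eval_X, map_ofNat,
          Matrix.cons_val_zero, Matrix.cons_val_one]
        field_simp
        ring
      · rw [genT_mulVec]
        simp [D, mul_pow, hζ3]
    c4_mem := by
      refine mem_discreteInvariants_of_semiinvariant (map_c4 _ 3) (c4_isHomogeneous_three K)
        (c := 9) (d := ζ) h9' hζ0 (fun v => ?_) fun v => ?_
      · rw [genS_three_mulVec]
        simp only [c4, map_mul, map_add, map_neg, map_pow, eval_X, map_ofNat,
          Matrix.cons_val_zero, Matrix.cons_val_one]
        field_simp
        ring
      · rw [genT_mulVec]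
        simp [c4]
        linear_combination ζ * v 1 ^ 4 * hζ3
    c6_mem := by
      refine mem_discreteInvariants_of_semiinvariant (map_c6 _ 3) (c6_isHomogeneous_three K)
        (c := -27) (d := 1) (neg_ne_zero.2 h27') one_ne_zero (fun v => ?_) fun v => ?_
      · rw [genS_three_mulVec]
        simp only [c6, map_mul, map_sub, map_pow, eval_X, map_ofNat, Matrix.cons_val_zero,
          Matrix.cons_val_one]
        field_simp
        ring
      · rw [genT_mulVec]
        have hζ6 : ζ ^ 6 = 1 := by rw [show 6 = 3 * 2 from rfl, pow_mul, hζ3, one_pow]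
        simp [c6, mul_pow, hζ3, hζ6]
    D_hom := D_isHomogeneous_three K
    c4_hom := c4_isHomogeneous_three K
    c6_hom := c6_isHomogeneous_three K
    restrict_D := restrict_D K 3
    restrict_c4 := restrict_c4 K 3 (by norm_num) (by norm_num)
    restrict_c6 := restrict_c6 K 3 (by norm_num) (by norm_num)
    restrict_pderiv := restrict_pderiv_D K 3 (by norm_num) (by norm_num)
    relation := c4_pow_sub_c6_pow K 3 (by norm_num) (by norm_num)
    jacobian_c4 := jacobian_D_c4 K 3 (by norm_num) (by norm_num)
    jacobian_c6 := jacobian_D_c6 K 3 (by norm_num) (by norm_num)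
    D_dvd := fun f hf h0 => by
      have hκ : (-(1 / 27) : AlgebraicClosure K) ≠ 0 := neg_ne_zero.2 (one_div_ne_zero h27')
      refine D_dvd_of_map_eq (neg_ne_zero.2 h27')
        (g := X 0 * (X 0 ^ 3 - C (-(1 / 27)) * X 1 ^ 3)) ?_
        (IsRelPrime.mul_dvd (isRelPrime_X_zero_pow_sub three_pos hκ) (X_zero_dvd h0)
          (binomial_dvd three_pos hζ hf h0 (isGammaMatrix_three h3' hζ') (by grind) hκ))
      have e : (C 27 * C (1 / 27) : MvPolynomial (Fin 2) (AlgebraicClosure K)) = 1 := by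
        rw [← C_mul, mul_one_div_cancel h27', C_1]
      have e' : (27 : MvPolynomial (Fin 2) (AlgebraicClosure K)) = C 27 := (map_ofNat C 27).symm
      simp only [D, map_neg]
      rw [e']
      linear_combination X 0 * X 1 ^ 3 * e
    coeff_eq_zero := fun f hf k hk => by
      refine coeff_restrict_eq_zero_of_mem hf (isGammaMatrix_three_neg_one h3' hζ') ?_
      rw [(Nat.not_even_iff_odd.1 fun h => hk h.two_dvd).neg_one_pow]
      intro h
      exact ofNat_ne_zero_algebraicClosure h2 (by linear_combination -h) }

end Three

/-! ### The case n = 4. -/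

section Four

theorem genS_four_mulVec (v : Fin 2 → AlgebraicClosure K) :
    (genS 4 ζ).mulVec v = ![v 0 + v 1 / 2, 2 * v 0 - v 1] := by
  ext i
  fin_cases i <;> simp [genS, Matrix.mulVec, dotProduct, Fin.sum_univ_two] <;> ring

theorem isGammaMatrix_four (h2 : (2 : AlgebraicClosure K) ≠ 0) (hζ : ζ ^ 2 = -1) :
    IsGammaMatrix 4 ζ !![(1 + ζ) / 2, (1 + ζ) / 2 * (-(1 / 2)); 1 - ζ, (1 - ζ) / 2] := by
  refine isGammaMatrix_commutator (by rintro rfl; simp at hζ) ?_ (by grind) ?_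
  · simp only [genS, Matrix.det_fin_two_of]
    grind
  · simp only [genS, genT, Matrix.mul_fin_two]
    apply matrix_fin_two_congr <;> grind

/-- The product of the commutator with its conjugate by T. -/
theorem isGammaMatrix_four_diag (h2 : (2 : AlgebraicClosure K) ≠ 0) (hζ : ζ ^ 2 = -1) :
    IsGammaMatrix 4 ζ !![ζ, 0; 0, -ζ] := by
  have hζ0 : ζ ≠ 0 := by rintro rfl; simp at hζ
  have h := isGammaMatrix_four h2 hζ
  refine h.mul_fin_two (h.conj_pow hζ0 1 (q' := (1 - ζ) / 4) (r' := -1 - ζ)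
    (by grind) (by grind)) ?_ ?_ ?_ ?_ <;> grind

/-- The diagonal matrix conjugated by the commutator. It exchanges the lines a = 0 and b = 0, which
accounts for the factor b of D. -/
theorem isGammaMatrix_four_antidiag (h2 : (2 : AlgebraicClosure K) ≠ 0) (hζ : ζ ^ 2 = -1) :
    IsGammaMatrix 4 ζ !![0, -(1 / 2); 2, 0] := by
  have h := isGammaMatrix_four h2 hζ
  have h' : IsGammaMatrix 4 ζ !![(1 - ζ) / 2, (1 + ζ) / 2 * (1 / 2); -(1 - ζ), (1 + ζ) / 2] := by
    refine h.of_mul_eq_one ?_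
    rw [Matrix.mul_fin_two, Matrix.one_fin_two]
    apply matrix_fin_two_congr <;> grind
  have h1 : IsGammaMatrix 4 ζ !![(ζ - 1) / 2, (ζ - 1) / 4; 1 + ζ, -(1 + ζ) / 2] := by
    refine h.mul_fin_two (isGammaMatrix_four_diag h2 hζ) ?_ ?_ ?_ ?_ <;> grind
  refine h1.mul_fin_two h' ?_ ?_ ?_ ?_ <;> grind

theorem covariantData_four (h2 : (2 : K) ≠ 0) (h3 : (3 : K) ≠ 0) (hζ : IsPrimitiveRoot ζ 4) :
    CovariantData K 4 ζ 4 := by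
  have hζ4 : ζ ^ 4 = 1 := hζ.pow_eq_one
  have hζ' : ζ ^ 2 = -1 := by
    have h1 : (ζ ^ 2 - 1) * (ζ ^ 2 + 1) = 0 := by linear_combination hζ4
    have h2 : ζ ^ 2 - 1 ≠ 0 := fun h =>
      hζ.pow_ne_one_of_pos_of_lt two_ne_zero (by norm_num) (sub_eq_zero.1 h)
    linear_combination (mul_eq_zero.1 h1).resolve_left h2
  have hζ0 : ζ ≠ 0 := hζ.ne_zero (by norm_num)
  have h2' : (2 : AlgebraicClosure K) ≠ 0 := ofNat_ne_zero_algebraicClosure h2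
  have h8' : (8 : AlgebraicClosure K) ≠ 0 := by
    rw [show (8 : AlgebraicClosure K) = 2 ^ 3 by norm_num]
    exact pow_ne_zero _ h2'
  have h16' : (16 : AlgebraicClosure K) ≠ 0 := by
    rw [show (16 : AlgebraicClosure K) = 2 ^ 4 by norm_num]
    exact pow_ne_zero _ h2'
  have h64' : (64 : AlgebraicClosure K) ≠ 0 := by
    rw [show (64 : AlgebraicClosure K) = 2 ^ 6 by norm_num]
    exact pow_ne_zero _ h2'
  have hζ8 : ζ ^ 8 = 1 := by rw [show 8 = 4 * 2 from rfl, pow_mul, hζ4, one_pow]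
  have hζ12 : ζ ^ 12 = 1 := by rw [show 12 = 4 * 3 from rfl, pow_mul, hζ4, one_pow]
  exact
  { two_le := by norm_num
    m_pos := four_pos
    two_ne := h2
    three_ne := h3
    m_ne := by convert! pow_ne_zero 2 h2 using 1; norm_num
    m_add_two_ne := by convert! mul_ne_zero h2 h3 using 1; norm_num
    D_mem := by
      refine mem_discreteInvariants_of_semiinvariant (map_D _ 4) (D_isHomogeneous_four K)
        (c := 8) (d := ζ) h8' hζ0 (fun v => ?_) fun v => ?_
      · rw [genS_four_mulVec]
        simp only [D, map_mul, map_sub, map_pow, eval_X, map_ofNat, Matrix.cons_val_zero,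
          Matrix.cons_val_one]
        field_simp
        ring
      · rw [genT_mulVec]
        simp [D, mul_pow, hζ4]
        ring
    c4_mem := by
      refine mem_discreteInvariants_of_semiinvariant (map_c4 _ 4) (c4_isHomogeneous_four K)
        (c := 16) (d := 1) h16' one_ne_zero (fun v => ?_) fun v => ?_
      · rw [genS_four_mulVec]
        simp only [c4, map_mul, map_add, map_pow, eval_X, map_ofNat, Matrix.cons_val_zero,
          Matrix.cons_val_one]
        field_simp
        ring
      · rw [genT_mulVec]
        simp [c4, mul_pow, hζ4, hζ8]
    c6_mem := by
      refine mem_discreteInvariants_of_semiinvariant (map_c6 _ 4) (c6_isHomogeneous_four K)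
        (c := -64) (d := 1) (neg_ne_zero.2 h64') one_ne_zero (fun v => ?_) fun v => ?_
      · rw [genS_four_mulVec]
        simp only [c6, map_mul, map_add, map_sub, map_neg, map_pow, eval_X, map_ofNat,
          Matrix.cons_val_zero, Matrix.cons_val_one]
        field_simp
        ring
      · rw [genT_mulVec]
        simp [c6, mul_pow, hζ4, hζ8, hζ12]
    D_hom := D_isHomogeneous_four K
    c4_hom := c4_isHomogeneous_four K
    c6_hom := c6_isHomogeneous_four K
    restrict_D := restrict_D K 4
    restrict_c4 := restrict_c4 K 4 (by norm_num) (by norm_num)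
    restrict_c6 := restrict_c6 K 4 (by norm_num) (by norm_num)
    restrict_pderiv := restrict_pderiv_D K 4 (by norm_num) (by norm_num)
    relation := c4_pow_sub_c6_pow K 4 (by norm_num) (by norm_num)
    jacobian_c4 := jacobian_D_c4 K 4 (by norm_num) (by norm_num)
    jacobian_c6 := jacobian_D_c6 K 4 (by norm_num) (by norm_num)
    D_dvd := fun f hf h0 => by
      have hκ : (1 / 16 : AlgebraicClosure K) ≠ 0 := one_div_ne_zero h16'
      have h1 := IsRelPrime.mul_dvd (isRelPrime_X_one_pow_sub four_pos _)
        (X_one_dvd hf h0 (isGammaMatrix_four_antidiag h2' hζ'))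
        (binomial_dvd four_pos hζ hf h0 (isGammaMatrix_four h2' hζ') (by norm_num) hκ)
      refine D_dvd_of_map_eq h16' (g := X 0 * (X 1 * (X 0 ^ 4 - C (1 / 16) * X 1 ^ 4))) ?_
        (IsRelPrime.mul_dvd (isRelPrime_X_zero_X_one.mul_right
          (isRelPrime_X_zero_pow_sub four_pos hκ)) (X_zero_dvd h0) h1)
      have e : (C 16 * C (1 / 16) : MvPolynomial (Fin 2) (AlgebraicClosure K)) = 1 := by
        rw [← C_mul, mul_one_div_cancel h16', C_1]
      have e' : (16 : MvPolynomial (Fin 2) (AlgebraicClosure K)) = C 16 := (map_ofNat C 16).symm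
      simp only [D]
      rw [e']
      linear_combination X 0 * X 1 ^ 5 * e
    coeff_eq_zero := fun f hf k hk => by
      refine coeff_restrict_eq_zero_of_mem hf (isGammaMatrix_four_diag h2' hζ') fun h => hk ?_
      -- The entry -ζ = ζ³ is again a primitive fourth root of unity.
      rw [show -ζ = ζ ^ 3 by linear_combination -ζ * hζ'] at h
      exact (hζ.pow_of_coprime 3 (by norm_num)).dvd_of_pow_eq_one k h }

end Four

end Small

/-! ### The data for `n = 5` -/

section Five

variable {K : Type*} [Field K] {ζ : AlgebraicClosure K}

local notation "φK" => algebraMap K (AlgebraicClosure K)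

theorem genS_five_mulVec (v : Fin 2 → AlgebraicClosure K) :
    (genS 5 ζ).mulVec v =
      ![(1 + ζ + ζ ^ 4) * v 0 + v 1, v 0 - (1 + ζ + ζ ^ 4) * v 1] := by
  ext i
  fin_cases i <;> simp [genS, Matrix.mulVec, dotProduct, Fin.sum_univ_two]
  ring

theorem golden_sq {F : Type*} [Field F] {ζ : F} (hζ : ζ ^ 4 + ζ ^ 3 + ζ ^ 2 + ζ + 1 = 0) :
    (1 + ζ + ζ ^ 4) ^ 2 = (1 + ζ + ζ ^ 4) + 1 := by
  linear_combination (ζ ^ 4 - ζ ^ 3 + 2 * ζ - 1) * hζ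

/-- The base is ζ³(1 - φ), and 1 - φ, the conjugate of φ, satisfies x⁵ = 3 + 5x as well. -/
theorem golden_conj_pow_five {F : Type*} [Field F] {ζ : F}
    (hζ : ζ ^ 4 + ζ ^ 3 + ζ ^ 2 + ζ + 1 = 0) :
    (-(-1 - ζ - ζ ^ 3)) ^ 5 = 8 + -5 * (1 + ζ + ζ ^ 4) := by
  grind

/-- The quantity x² + xy - y² is the norm of x + yφ, its product with x + y - yφ. -/
theorem golden_ne_zero {F : Type*} [Field F] {φ x y z : F} (hφ : φ ^ 2 = φ + 1) (hz : z ≠ 0)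
    (h : x ^ 2 + x * y - y ^ 2 = z) : x + y * φ ≠ 0 := by
  intro h0
  apply hz
  linear_combination (x + y - y * φ) * h0 + y ^ 2 * hφ - h

theorem isGammaMatrix_five (h5 : (5 : AlgebraicClosure K) ≠ 0)
    (hζ : ζ ^ 4 + ζ ^ 3 + ζ ^ 2 + ζ + 1 = 0) :
    IsGammaMatrix 5 ζ !![(1 + 2 * ζ - 2 * ζ ^ 2 - ζ ^ 3) / 5,
        (1 + 2 * ζ - 2 * ζ ^ 2 - ζ ^ 3) / 5 * (-1 - ζ - ζ ^ 3);
      (-3 - ζ - 4 * ζ ^ 2 - 2 * ζ ^ 3) / 5, (-1 - 2 * ζ - 3 * ζ ^ 2 - 4 * ζ ^ 3) / 5] := by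
  have hφ := golden_sq hζ
  refine isGammaMatrix_commutator (by rintro rfl; simp at hζ) ?_ (by grind) ?_
  · simp only [genS, Matrix.det_fin_two_of]
    intro h
    exact golden_ne_zero hφ h5 (x := 2) (y := 1) (by norm_num) (by linear_combination -h - hφ)
  · simp only [genS, genT, Matrix.mul_fin_two]
    apply matrix_fin_two_congr <;> grind

theorem isGammaMatrix_five_diag (h5 : (5 : AlgebraicClosure K) ≠ 0)
    (hζ : ζ ^ 4 + ζ ^ 3 + ζ ^ 2 + ζ + 1 = 0) : IsGammaMatrix 5 ζ !![-ζ ^ 3, 0; 0, -ζ ^ 2] := by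
  have hζ0 : ζ ≠ 0 := by rintro rfl; simp at hζ
  have h := isGammaMatrix_five h5 hζ
  refine h.mul_fin_two (h.conj_pow hζ0 2 (q' := (2 - ζ + ζ ^ 2 - 2 * ζ ^ 3) / 5)
    (r' := (-3 - ζ + ζ ^ 2 - 2 * ζ ^ 3) / 5) (by grind) (by grind)) ?_ ?_ ?_ ?_ <;> grind

/-- Here the ratio of the first row is ζ² + ζ³ = -φ, which gives the five zeros of D belonging to
φ⁵; the commutator itself gives those belonging to (1 - φ)⁵. -/
theorem isGammaMatrix_five_sq (h5 : (5 : AlgebraicClosure K) ≠ 0)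
    (hζ : ζ ^ 4 + ζ ^ 3 + ζ ^ 2 + ζ + 1 = 0) :
    IsGammaMatrix 5 ζ !![(-2 + ζ - ζ ^ 2 - 3 * ζ ^ 3) / 5,
        (-2 + ζ - ζ ^ 2 - 3 * ζ ^ 3) / 5 * (ζ ^ 2 + ζ ^ 3);
      (1 - 3 * ζ - 2 * ζ ^ 2 - ζ ^ 3) / 5, (-3 - ζ - 4 * ζ ^ 2 - 2 * ζ ^ 3) / 5] := by
  have h := isGammaMatrix_five h5 hζ
  refine h.mul_fin_two h ?_ ?_ ?_ ?_ <;> grind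

theorem isGammaMatrix_five_antidiag (h5 : (5 : AlgebraicClosure K) ≠ 0)
    (hζ : ζ ^ 4 + ζ ^ 3 + ζ ^ 2 + ζ + 1 = 0) : IsGammaMatrix 5 ζ !![0, ζ ^ 3; -ζ ^ 2, 0] := by
  have hζ0 : ζ ≠ 0 := by rintro rfl; simp at hζ
  refine (isGammaMatrix_five_sq h5 hζ).mul_fin_two ((isGammaMatrix_five h5 hζ).conj_pow hζ0 4
    (q' := (-3 - ζ + ζ ^ 2 - 2 * ζ ^ 3) / 5) (r' := (2 - ζ + ζ ^ 2 - 2 * ζ ^ 3) / 5)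
    (by grind) (by grind)) ?_ ?_ ?_ ?_ <;> grind

theorem covariantData_five (h2 : (2 : K) ≠ 0) (h3 : (3 : K) ≠ 0) (h5 : (5 : K) ≠ 0)
    (hζ : IsPrimitiveRoot ζ 5) : CovariantData K 5 ζ 10 := by
  have hζ5 : ζ ^ 5 = 1 := hζ.pow_eq_one
  have hζ' : ζ ^ 4 + ζ ^ 3 + ζ ^ 2 + ζ + 1 = 0 := by
    have := hζ.geom_sum_eq_zero (by norm_num)
    simp only [Finset.sum_range_succ, Finset.sum_range_zero, pow_zero, pow_one] at this
    linear_combination this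
  have hζ0 : ζ ≠ 0 := hζ.ne_zero (by norm_num)
  have h5' : (5 : AlgebraicClosure K) ≠ 0 := ofNat_ne_zero_algebraicClosure h5
  have hmul : ∀ j, ζ ^ (5 * j) = 1 := fun j => by rw [pow_mul, hζ5, one_pow]
  have hζ10 : ζ ^ 10 = 1 := hmul 2
  have hζ15 : ζ ^ 15 = 1 := hmul 3
  have hζ20 : ζ ^ 20 = 1 := hmul 4
  have hζ25 : ζ ^ 25 = 1 := hmul 5
  have hζ30 : ζ ^ 30 = 1 := hmul 6
  have hφ := golden_sq hζ'
  exact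
  { two_le := by norm_num
    m_pos := by norm_num
    two_ne := h2
    three_ne := h3
    m_ne := by convert! mul_ne_zero h2 h5 using 1; norm_num
    m_add_two_ne := by convert! mul_ne_zero (pow_ne_zero 2 h2) h3 using 1; norm_num
    D_mem := by
      have h125 : (125 : AlgebraicClosure K) ≠ 0 := by
        rw [show (125 : AlgebraicClosure K) = 5 ^ 3 by norm_num]
        exact pow_ne_zero _ h5'
      refine mem_discreteInvariants_of_semiinvariant (map_D _ 5) (D_isHomogeneous_five K)
        (c := 125 * (5 + 8 * (1 + ζ + ζ ^ 4))) (d := ζ)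
        (mul_ne_zero h125 (golden_ne_zero hφ one_ne_zero (by norm_num))) hζ0
        (fun v => ?_) fun v => ?_
      · rw [genS_five_mulVec]
        simp only [D, map_mul, map_sub, map_pow, eval_X, map_ofNat, Matrix.cons_val_zero,
          Matrix.cons_val_one]
        exact golden_D hφ _ _
      · rw [genT_mulVec]
        simp [D, mul_pow, hζ5, hζ10]
        ring
    c4_mem := by
      have h3125 : (3125 : AlgebraicClosure K) ≠ 0 := by
        rw [show (3125 : AlgebraicClosure K) = 5 ^ 5 by norm_num]
        exact pow_ne_zero _ h5'
      refine mem_discreteInvariants_of_semiinvariant (map_c4 _ 5) (c4_isHomogeneous_five K)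
        (c := 3125 * (34 + 55 * (1 + ζ + ζ ^ 4))) (d := 1)
        (mul_ne_zero h3125 (golden_ne_zero hφ one_ne_zero (by norm_num))) one_ne_zero
        (fun v => ?_) fun v => ?_
      · rw [genS_five_mulVec]
        simp only [c4, map_mul, map_add, map_sub, map_pow, eval_X, map_ofNat,
          Matrix.cons_val_zero, Matrix.cons_val_one]
        exact golden_c4 hφ _ _
      · rw [genT_mulVec]
        simp [c4, mul_pow, hζ5, hζ10, hζ15, hζ20]
    c6_mem := by
      have h78125 : (78125 : AlgebraicClosure K) ≠ 0 := by
        rw [show (78125 : AlgebraicClosure K) = 5 ^ 7 by norm_num]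
        exact pow_ne_zero _ h5'
      refine mem_discreteInvariants_of_semiinvariant (map_c6 _ 5) (c6_isHomogeneous_five K)
        (c := -(78125 * (843 + 1364 * (1 + ζ + ζ ^ 4)))) (d := 1)
        (neg_ne_zero.2 (mul_ne_zero h78125 (golden_ne_zero hφ h5' (by norm_num)))) one_ne_zero
        (fun v => ?_) fun v => ?_
      · rw [genS_five_mulVec]
        simp only [c6, map_mul, map_add, map_sub, map_neg, map_pow, eval_X, map_ofNat,
          Matrix.cons_val_zero, Matrix.cons_val_one]
        exact golden_c6 hφ _ _
      · rw [genT_mulVec]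
        simp [c6, mul_pow, hζ5, hζ10, hζ20, hζ25, hζ30]
    D_hom := D_isHomogeneous_five K
    c4_hom := c4_isHomogeneous_five K
    c6_hom := c6_isHomogeneous_five K
    restrict_D := restrict_D K 5
    restrict_c4 := restrict_c4 K 5 (by norm_num) (by norm_num)
    restrict_c6 := restrict_c6 K 5 (by norm_num) (by norm_num)
    restrict_pderiv := restrict_pderiv_D K 5 (by norm_num) (by norm_num)
    relation := c4_pow_sub_c6_pow K 5 (by norm_num) (by norm_num)
    jacobian_c4 := jacobian_D_c4 K 5 (by norm_num) (by norm_num)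
    jacobian_c6 := jacobian_D_c6 K 5 (by norm_num) (by norm_num)
    D_dvd := fun f hf h0 => by
      have five_pos : 0 < 5 := by norm_num
      obtain ⟨φ, hφζ⟩ : ∃ φ, φ = 1 + ζ + ζ ^ 4 := ⟨_, rfl⟩
      rw [← hφζ] at hφ
      have hφ' : φ = -(ζ ^ 2 + ζ ^ 3) := by linear_combination hφζ + hζ'
      have hφ5 : φ ^ 5 = 3 + 5 * φ := by
        linear_combination (φ ^ 3 + φ ^ 2 + 2 * φ + 3) * hφ
      have hκ : 3 + 5 * φ ≠ 0 := golden_ne_zero hφ (neg_ne_zero.2 one_ne_zero) (by norm_num)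
      have hκ' : 8 + -5 * φ ≠ 0 := golden_ne_zero hφ (neg_ne_zero.2 one_ne_zero) (by norm_num)
      have hsub : 8 + -5 * φ - (3 + 5 * φ) ≠ 0 := by
        have := golden_ne_zero (x := 5) (y := -10) hφ
          (neg_ne_zero.2 (pow_ne_zero 3 h5')) (by norm_num)
        intro h
        exact this (by linear_combination h)
      have hd1 := binomial_dvd five_pos hζ hf h0 (isGammaMatrix_five_sq h5' hζ')
        (κ := 3 + 5 * φ) (by rw [← hφ', hφ5]) hκ
      have hd2 := binomial_dvd five_pos hζ hf h0 (isGammaMatrix_five h5' hζ')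
        (κ := 8 + -5 * φ) (by rw [hφζ]; exact golden_conj_pow_five hζ') hκ'
      have h1 := IsRelPrime.mul_dvd (isRelPrime_pow_sub_pow_sub hsub) hd1 hd2
      have h2 := IsRelPrime.mul_dvd ((isRelPrime_X_one_pow_sub five_pos _).mul_right
        (isRelPrime_X_one_pow_sub five_pos _))
        (X_one_dvd hf h0 (isGammaMatrix_five_antidiag h5' hζ')) h1
      have h3 := IsRelPrime.mul_dvd (isRelPrime_X_zero_X_one.mul_right
        ((isRelPrime_X_zero_pow_sub five_pos hκ).mul_right
          (isRelPrime_X_zero_pow_sub five_pos hκ'))) (X_zero_dvd h0) h2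
      refine D_dvd_of_map_eq one_ne_zero ?_ h3
      -- The constants φ⁵ and (1 - φ)⁵ have sum 11 and product -1, so the two binomials multiply to
      -- a¹⁰ - 11a⁵b⁵ - b¹⁰.
      have e : (C (3 + 5 * φ) + C (8 + -5 * φ) : MvPolynomial (Fin 2) (AlgebraicClosure K)) =
          11 := by
        rw [← C_add, ← map_ofNat C 11]
        congr 1
        ring
      have e' : (C (3 + 5 * φ) * C (8 + -5 * φ) : MvPolynomial (Fin 2) (AlgebraicClosure K)) =
          -1 := by
        rw [← C_mul, ← C_1, ← C_neg]
        congr 1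
        linear_combination -25 * hφ
      simp only [D, C_1]
      linear_combination X 0 ^ 6 * X 1 ^ 6 * e - X 0 * X 1 ^ 11 * e'
    coeff_eq_zero := fun f hf k hk => by
      refine coeff_restrict_eq_zero_of_mem hf (isGammaMatrix_five_diag h5' hζ') fun h => hk ?_
      -- Squaring removes the sign of -ζ² and gives 5 ∣ k; the sign that remains then forces k to be
      -- even.
      have h4 : ζ ^ (4 * k) = 1 := by
        have : ((-ζ ^ 2) ^ k) ^ 2 = ζ ^ (4 * k) := by
          rw [← pow_mul (-ζ ^ 2), mul_comm k 2, pow_mul, pow_mul, neg_sq, ← pow_mul ζ]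
        rw [← this, h, one_pow]
      have hdvd : 5 ∣ k :=
        (show Nat.Coprime 5 4 by norm_num).dvd_of_dvd_mul_left (hζ.dvd_of_pow_eq_one _ h4)
      obtain ⟨j, rfl⟩ := hdvd
      rw [neg_pow, ← pow_mul, show 2 * (5 * j) = 5 * (2 * j) by ring, hmul, mul_one] at h
      have he : Even (5 * j) := by
        by_contra ho
        rw [(Nat.not_even_iff_odd.1 ho).neg_one_pow] at h
        exact ofNat_ne_zero_algebraicClosure h2 (by linear_combination -h)
      exact (show Nat.Coprime 2 5 by norm_num).mul_dvd_of_dvd_of_dvd he.two_dvd ⟨j, rfl⟩ }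

end Five

end DiscCov

end

/-! ### Assembly of the four cases. -/

theorem theorem5p2 (K : Type*) [Field K] [PerfectField K] (n : ℕ) (h2 : 2 ≤ n) (h5 : n ≤ 5)
    (hchar : ((6 * n : ℕ) : K) ≠ 0) (ζ : AlgebraicClosure K) (hζ : IsPrimitiveRoot ζ n) :
    ∃ (h4 : DiscCov.c4 K n ∈ DiscCov.discreteInvariants K n ζ)
      (h6 : DiscCov.c6 K n ∈ DiscCov.discreteInvariants K n ζ)
      (B : Module.Basis (Fin (n - 1) ⊕ Fin (n - 1) ⊕ Fin 2)
        (DiscCov.ringC4C6 K n ζ h4 h6) (DiscCov.discreteCovariants K n ζ)),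
      (∀ i : Fin (n - 1), (B (.inl i) : Fin 2 → MvPolynomial (Fin 2) K) =
        DiscCov.D K n ^ (i : ℕ) • DiscCov.U K) ∧
      (∀ i : Fin (n - 1), (B (.inr (.inl i)) : Fin 2 → MvPolynomial (Fin 2) K) =
        DiscCov.D K n ^ (i : ℕ) • DiscCov.del (DiscCov.D K n)) ∧
      (B (.inr (.inr 0)) : Fin 2 → MvPolynomial (Fin 2) K) = DiscCov.del (DiscCov.c4 K n) ∧
      (B (.inr (.inr 1)) : Fin 2 → MvPolynomial (Fin 2) K) = DiscCov.del (DiscCov.c6 K n) ∧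
      Module.rank (DiscCov.ringC4C6 K n ζ h4 h6) (DiscCov.discreteCovariants K n ζ) = 2 * n := by
  have hn : (n : K) ≠ 0 := fun h => hchar (by rw [Nat.cast_mul, h, mul_zero])
  have h6 : (2 : K) * 3 ≠ 0 := fun h => hchar (by
    rw [Nat.cast_mul, show ((6 : ℕ) : K) = 2 * 3 by norm_num, h, zero_mul])
  have h2' : (2 : K) ≠ 0 := left_ne_zero_of_mul h6
  have h3' : (3 : K) ≠ 0 := right_ne_zero_of_mul h6
  interval_cases n
  · have H := DiscCov.covariantData_two h2' h3' hζ
    exact H.exists_basis fun f hf hf1 => H.restrict_eq_zero_of_isHomogeneous (Or.inl rfl) hf hf1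
  · have hζ' : ζ ^ 2 + ζ + 1 = 0 := by
      have := hζ.geom_sum_eq_zero (by norm_num)
      simp only [Finset.sum_range_succ, Finset.sum_range_zero, pow_zero, pow_one] at this
      linear_combination this
    exact (DiscCov.covariantData_three h2' h3' hζ).exists_basis fun f hf hf2 =>
      DiscCov.restrict_eq_zero_of_isHomogeneous_two
        (DiscCov.ofNat_ne_zero_algebraicClosure h2') (DiscCov.ofNat_ne_zero_algebraicClosure h3')
        hζ' hf hf2
  · have H := DiscCov.covariantData_four h2' h3' hζ
    exact H.exists_basis fun f hf hf4 =>
      H.restrict_eq_zero_of_isHomogeneous (Or.inr ⟨by norm_num, le_rfl⟩) hf hf4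
  · have H := DiscCov.covariantData_five h2' h3' (by simpa using hn) hζ
    exact H.exists_basis fun f hf hf10 =>
      H.restrict_eq_zero_of_isHomogeneous (Or.inr ⟨by norm_num, by norm_num⟩) hf hf10
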